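/- Let $L>0$. For $0<\gamma<2/L$ put $L_\gamma=\frac{2}{\gamma}\big(\sqrt{1+\gamma L/2}-\sqrt{1-\gamma L/2}\big)$ and $$\delta(x)=-\frac{3L_\gamma}{4L}\,\frac{\gamma}{\sqrt{1+\frac{\gamma L}{2}}-\frac{\gamma L_\gamma x}{2L}}\quad(x\in[0,L]),\qquad \Lambda=\begin{pmatrix}1&0\\0&-1\end{pmatrix},\qquad J_0=\begin{pmatrix}1&\frac13\\-\frac13&-1\end{pmatrix}.$$ Let $\langle f,g\rangle=\frac1{2L}\int_0^L(f_1\overline{g_1}+f_2\overline{g_2})\,dx$, and consider in $L^2((0,L);\mathbb C^2)$ the operator $T_\gamma=\Lambda\partial_x+\delta J_0$ and its adjoint $T_\gamma^*=-\Lambda\partial_x+\delta J_0^*$, both with domain $\{w\in H^1((0,L);\mathbb C^2): w_1(0)=-w_2(0),\ w_1(L)=-w_2(L)\}$. For $n\in\mathbb Z$ put $\mu_n^{(0)}=i\pi n/L$ and $\psi_n^{(0)}=\chi_n^{(0)}=(e^{i\pi nx/L},-e^{-i\pi nx/L})$; these are the eigenvalues of $T=\Lambda\partial_x$ (same domain)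 and eigenfunctions of $T$ and, for $\overline{\mu_n^{(0)}}$, of $T^*$. For small $\gamma>0$ let $\mu_n(\gamma)$ be the eigenvalue of $T_\gamma$ that depends continuously on $\gamma$ and tends to $\mu_n^{(0)}$ as $\gamma\to0^+$; let $\psi_n(\gamma)$ be an eigenfunction of $T_\gamma$ for $\mu_n(\gamma)$ and $\chi_n(\gamma)$ an eigenfunction of $T_\gamma^*$ for $\overline{\mu_n(\gamma)}$, normalized by $\langle\psi_n(\gamma),\chi_n^{(0)}\rangle=1$ and $\langle\psi_n^{(0)},\chi_n(\gamma)\rangle=1$. Let $b_n=\langle\chi_n(\gamma),(1,1)\rangle$. **Lemma.** There are $\gamma_0\in(0,2/L)$ and $c,C>0$, depending only on $L$, such that such families $\mu_n,\psi_n,\chi_n$ $(n\in\mathbb Z)$ exist for $\gamma\in(0,\gamma_0)$, and for any such families and every $\gamma\in(0,\gamma_0)$: 1. $(\psi_n(\gamma))_{n\in\mathbb Z}$ is a Riesz basis of $L^2((0,L);\mathbb C^2)$; 2. $|\langle\psi_n(\gamma),\chi_n(\gamma)\rangle|\in(1/2,2)$ for all $n\in\mathbb Z$; 3. $|\mu_n(\gamma)-\mu_n^{(0)}|<\frac1{4L}$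 for all $n\in\mathbb Z$; 4. $b_0=0$ and $\gamma\,\dfrac{c}{|n|}<|b_n|<\dfrac{C}{|n|}$ for all $n\in\mathbb Z\setminus\{0\}$. -/

import Mathlib

open MeasureTheory Set Filter Topology

noncomputable section

namespace WaterTank

/-- The value space `ℂ²` of the state `w = (w₁, w₂)`; the components are `w x 0` and `w x 1`. -/
abbrev C2 : Type := EuclideanSpace ℂ (Fin 2)

/-- The Hilbert space `L²((0, L); ℂ²)`. -/
abbrev L2Space (L : ℝ) : Type := Lp C2 2 (volume.restrict (Ioo (0 : ℝ) L))

/-- `Λ = diag (1, -1)`. -/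
def Lam : Matrix (Fin 2) (Fin 2) ℂ := !![1, 0; 0, -1]

/-- The coupling matrix `J₀`. -/
def J0 : Matrix (Fin 2) (Fin 2) ℂ := !![1, 1 / 3; -(1 / 3), -1]

/-- `L_γ = (2 / γ) (√(1 + γ L / 2) - √(1 - γ L / 2))`. -/
def Lgam (L γ : ℝ) : ℝ :=
  2 / γ * (Real.sqrt (1 + γ * L / 2) - Real.sqrt (1 - γ * L / 2))

/-- The coefficient `δ` of the coupling term. -/
def delta (L γ x : ℝ) : ℝ :=
  -(3 * Lgam L γ / (4 * L)) * (γ / (Real.sqrt (1 + γ * L / 2) - γ * Lgam L γ * x / (2 * L)))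

/-- The expression `Λ ∂ₓ w + δ J₀ w` at the point `x`. -/
def S0 (L γ : ℝ) (w : ℝ → C2) (x : ℝ) : C2 :=
  Matrix.toEuclideanLin Lam (deriv w x) +
    (delta L γ x : ℂ) • Matrix.toEuclideanLin J0 (w x)

/-- The adjoint expression `-Λ ∂ₓ w + δ J₀* w` at the point `x` (`δ` is real). -/
def S0Adj (L γ : ℝ) (w : ℝ → C2) (x : ℝ) : C2 :=
  -Matrix.toEuclideanLin Lam (deriv w x) +
    (delta L γ x : ℂ) • Matrix.toEuclideanLin J0.conjTranspose (w x)

/-- `w` is (the continuous representative of) an element of `H¹((0, L); ℂ²)`: it is absolutely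
continuous on `[0, L]` and its derivative is square integrable. -/
def MemH1 (L : ℝ) (w : ℝ → C2) : Prop :=
  AbsolutelyContinuousOnInterval w 0 L ∧ MemLp (deriv w) 2 (volume.restrict (Ioo (0 : ℝ) L))

/-- The common domain of the operator and of its adjoint: `w ∈ H¹((0, L); ℂ²)` with
`w₁(0) = -w₂(0)` and `w₁(L) = -w₂(L)`. -/
def MemDomain (L : ℝ) (w : ℝ → C2) : Prop :=
  MemH1 L w ∧ w 0 0 = -w 0 1 ∧ w L 0 = -w L 1

/-- `w` is an eigenfunction, for the eigenvalue `z`, of the operator given by the differential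
expression `S` on the above domain. -/
def IsEigenfunction (L : ℝ) (S : (ℝ → C2) → ℝ → C2) (z : ℂ) (w : ℝ → C2) : Prop :=
  MemDomain L w ∧ (∃ x ∈ Icc (0 : ℝ) L, w x ≠ 0) ∧
    ∀ᵐ x ∂(volume.restrict (Ioo (0 : ℝ) L)), S w x = z • w x

/-- The scalar product `⟨f, g⟩ = 1 / (2 L) ∫₀ᴸ (f₁ ḡ₁ + f₂ ḡ₂) dx`. -/
def pairing (L : ℝ) (f g : ℝ → C2) : ℂ :=
  (1 / (2 * L) : ℂ) *
    ∫ x in (0 : ℝ)..L, (f x 0 * (starRingEnd ℂ) (g x 0) + f x 1 * (starRingEnd ℂ) (g x 1))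

/-- The eigenvalue `i π n / L` of `Λ ∂ₓ`. -/
def mu0 (L : ℝ) (n : ℤ) : ℂ := Complex.I * (Real.pi : ℂ) * (n : ℂ) / (L : ℂ)

/-- The function `(e^{i π n x / L}, -e^{-i π n x / L})`: the normalized eigenfunction of `Λ ∂ₓ` for
`i π n / L`, and of its adjoint `-Λ ∂ₓ` for the conjugate eigenvalue `-i π n / L`. -/
def psi0 (L : ℝ) (n : ℤ) (x : ℝ) : C2 :=
  !₂[Complex.exp (Complex.I * (Real.pi : ℂ) * (n : ℂ) * (x : ℂ) / (L : ℂ)),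
    -Complex.exp (-(Complex.I * (Real.pi : ℂ) * (n : ℂ) * (x : ℂ) / (L : ℂ)))]

/-- The constant control profile `(1, 1)`. -/
def controlProfile : ℝ → C2 := fun _ => !₂[1, 1]

/-- The perturbed eigenvalues `μ n γ` and eigenfunctions `ψ n γ`, `χ n γ` for `γ ∈ (0, γ₀)`:
`μ n` is the continuous branch of eigenvalues of `Λ ∂ₓ + δ J₀` that issues from `i π n / L` at
`γ = 0`; `ψ n γ` (resp. `χ n γ`) is an eigenfunction of the operator for `μ n γ` (resp. of the
adjoint for the conjugate of `μ n γ`), normalized against the unperturbed eigenfunction. -/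
structure IsPerturbedEigenfamily (L γ₀ : ℝ) (μ : ℤ → ℝ → ℂ) (ψ χ : ℤ → ℝ → ℝ → C2) : Prop where
  continuousOn : ∀ n, ContinuousOn (μ n) (Ioo 0 γ₀)
  tendsto_zero : ∀ n, Tendsto (μ n) (𝓝[>] 0) (𝓝 (mu0 L n))
  eigen : ∀ n, ∀ γ ∈ Ioo 0 γ₀, IsEigenfunction L (S0 L γ) (μ n γ) (ψ n γ)
  eigen_adj : ∀ n, ∀ γ ∈ Ioo 0 γ₀,
    IsEigenfunction L (S0Adj L γ) ((starRingEnd ℂ) (μ n γ)) (χ n γ)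
  norm_psi : ∀ n, ∀ γ ∈ Ioo 0 γ₀, pairing L (ψ n γ) (psi0 L n) = 1
  norm_chi : ∀ n, ∀ γ ∈ Ioo 0 γ₀, pairing L (psi0 L n) (χ n γ) = 1

/-- A Riesz basis of a Hilbert space: the image of an orthonormal basis under a bounded operator
with bounded inverse. -/
def IsRieszBasis {ι H : Type*} [NormedAddCommGroup H] [InnerProductSpace ℂ H] (v : ι → H) : Prop :=
  ∃ (b : HilbertBasis ι ℂ H) (T : H ≃L[ℂ] H), ∀ i, v i = T (b i)

/-- The functions `v i` lie in `L²((0, L); ℂ²)` and their classes form a Riesz basis of it. (The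
factor `1 / (2 L)` in `pairing` does not affect this property.) -/
def IsRieszBasisL2 {ι : Type*} (L : ℝ) (v : ι → ℝ → C2) : Prop :=
  ∃ h : ∀ i, MemLp (v i) 2 (volume.restrict (Ioo (0 : ℝ) L)),
    IsRieszBasis (fun i => ((h i).toLp (v i) : L2Space L))

/-- The moment `b_n = ⟨χ_n, (1, 1)⟩`. -/
def moment (L : ℝ) (χ : ℤ → ℝ → ℝ → C2) (n : ℤ) (γ : ℝ) : ℂ := pairing L (χ n γ) controlProfile

end WaterTank

end

/-!
Inverting `Λ`, the eigenvalue equations of the operator and of its adjoint become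
`w₁' = (ζ + p) w₁ - q w₂`, `w₂' = -q w₁ + (-ζ + p) w₂` with `q = δ / 3` and `p = -δ`, resp. `p = δ`.
Up to the weight `exp (-2 ∫ p)` this system is skew-adjoint, so `ζ = i s` with `s` real, and the
solutions that satisfy the boundary condition at `0` are the multiples of `(r e^{iθ}, -r e^{-iθ})`
with `θ' = s - q sin (2 θ)`, `θ(0) = 0` and `r' = (p + q cos (2 θ)) r`, `r(0) = 1`. The boundary
condition at `L` says `θ(L) ∈ π ℤ`. Since `θ(L)` is strictly increasing in `s`, this determines one
eigenvalue for each `n`, which moves continuously with `γ` and stays within `γ / 2` of `i π n / L`.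

* Basis property: `p` contributes to `r` only the factor `exp (∫ p)`, which does not depend on `n`.
  Without it the functions are orthogonal in `L²`, and since `q` varies slowly their distance to the
  unperturbed eigenfunctions is `O(γ L / |n|)`. The sum of the squares of these distances is small,
  so the orthogonal family is complete.
* Moments: the inner product of `(r e^{iθ}, -r e^{-iθ})` with `(1, 1)` is a multiple of `∫ r sin θ`.
  For `p = δ` the identity `δ' = -(2 / 3) δ²` makes `r cos θ - (p + q) r sin θ / s` a primitive of
  `-s r sin θ`. Hence `s ∫ r sin θ = 1 ∓ r(L)`, and `1 - r(L)` is positive of order `γ L` because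
  `δ` is negative of order `γ`.
-/

noncomputable section

namespace WaterTank

open scoped ComplexConjugate ENNReal NNReal

section ODE

theorem exists_forall_hasDerivAt_of_lipschitzWith {E : Type*} [NormedAddCommGroup E]
    [NormedSpace ℝ E] [CompleteSpace E] {f : ℝ → E → E} {K M : ℝ≥0} {a b : ℝ} (hab : a ≤ b)
    (hf : ∀ y, Continuous fun t => f t y) (hK : ∀ t, LipschitzWith K (f t))
    (hM : ∀ t y, ‖f t y‖ ≤ M) (y₀ : E) :
    ∃ y : ℝ → E, Continuous y ∧ y a = y₀ ∧ ∀ t ∈ Icc a b, HasDerivAt y (f t (y t)) t := by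
  -- Solving on a larger interval makes the derivative two-sided at the end points of `[a, b]`.
  have hle : a - 1 ≤ b + 1 := by linarith
  have ha : a ∈ Icc (a - 1) (b + 1) := ⟨by linarith, by linarith⟩
  have hpl : IsPicardLindelof f (⟨a, ha⟩ : Icc (a - 1) (b + 1)) y₀
      (M * Real.toNNReal (b - a + 1)) 0 M K :=
    ⟨fun t _ => (hK t).lipschitzOnWith, fun y _ => (hf y).continuousOn, fun t _ y _ => hM t y, by
      have hmax : max (b + 1 - a) (a - (a - 1)) ≤ b - a + 1 := max_le (by linarith) (by linarith)
      rw [NNReal.coe_mul, Real.coe_toNNReal _ (by linarith), NNReal.coe_zero, sub_zero]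
      exact mul_le_mul_of_nonneg_left hmax M.coe_nonneg⟩
  obtain ⟨y, hy0, hy⟩ := hpl.exists_eq_forall_mem_Icc_hasDerivWithinAt₀
  have hcont : ContinuousOn y (Icc (a - 1) (b + 1)) := fun t ht => (hy t ht).continuousWithinAt
  have heq : ∀ t ∈ Icc (a - 1) (b + 1),
      IccExtend hle ((Icc (a - 1) (b + 1)).domRestrict y) t = y t :=
    fun t ht => by simp [IccExtend_of_mem hle _ ht]
  refine ⟨IccExtend hle ((Icc (a - 1) (b + 1)).domRestrict y), hcont.domRestrict.Icc_extend', ?_,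
    fun t ht => ?_⟩
  · rw [heq a ha, hy0]
  · have hnhds : Icc (a - 1) (b + 1) ∈ 𝓝 t :=
      Icc_mem_nhds (by linarith [ht.1]) (by linarith [ht.2])
    rw [heq t (mem_of_mem_nhds hnhds)]
    exact ((hy t (mem_of_mem_nhds hnhds)).hasDerivAt hnhds).congr_of_eventuallyEq
      (eventually_of_mem hnhds heq)

theorem pos_of_hasDerivAt_sub_mul_self {a b : ℝ} (hab : a < b) {φ g h : ℝ → ℝ}
    (hh : Continuous h) (hg : ∀ x ∈ Icc a b, 0 < g x) (h0 : φ a = 0)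
    (hφ : ∀ x ∈ Icc a b, HasDerivAt φ (g x - h x * φ x) x) : 0 < φ b := by
  let H : ℝ → ℝ := fun x => ∫ t in a..x, h t
  have hderiv : ∀ x ∈ Icc a b,
      HasDerivAt (fun x => Real.exp (H x) * φ x) (Real.exp (H x) * g x) x := by
    intro x hx
    convert! (hh.integral_hasStrictDerivAt a x).hasDerivAt.exp.mul (hφ x hx) using 1
    ring
  have hmono : StrictMonoOn (fun x => Real.exp (H x) * φ x) (Icc a b) := by
    refine strictMonoOn_of_deriv_pos (convex_Icc _ _)
      (fun x hx => (hderiv x hx).continuousAt.continuousWithinAt) fun x hx => ?_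
    have hx' := interior_subset hx
    rw [(hderiv x hx').deriv]
    exact mul_pos (Real.exp_pos _) (hg x hx')
  have := hmono (left_mem_Icc.2 hab.le) (right_mem_Icc.2 hab.le) hab
  simp only [h0, mul_zero] at this
  exact pos_of_mul_pos_right this (Real.exp_pos _).le

end ODE

section PruferAngle

/-- `θ` is the Prüfer angle on `[0, L]`, at the real spectral parameter `s` and started from `0`, of
the Dirac system `w₁' = i s w₁ - q w₂`, `w₂' = -i s w₂ - q w₁`: the solutions of this system with
`w₁(0) = -w₂(0)` are multiples of `(r e^{iθ}, -r e^{-iθ})`, with `r` positive. -/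
structure IsPruferAngle (L : ℝ) (q : ℝ → ℝ) (s : ℝ) (θ : ℝ → ℝ) : Prop where
  continuous : Continuous θ
  apply_zero : θ 0 = 0
  hasDerivAt : ∀ x ∈ Icc 0 L, HasDerivAt θ (s - q x * Real.sin (2 * θ x)) x

variable {L k η s s' : ℝ} {q q' θ θ' : ℝ → ℝ}

theorem abs_sin_two_mul_sub_sin_two_mul_le (a b : ℝ) :
    |Real.sin (2 * a) - Real.sin (2 * b)| ≤ 2 * |a - b| := by
  have := Real.abs_sin_sub_sin_le (2 * a) (2 * b)
  rwa [← mul_sub, abs_mul, abs_two] at this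

theorem sin_two_mul_sub_sin_two_mul (a b : ℝ) :
    Real.sin (2 * a) - Real.sin (2 * b) = 2 * Real.cos (a + b) * Real.sinc (a - b) * (a - b) := by
  have hsinc : Real.sinc (a - b) * (a - b) = Real.sin (a - b) := by
    rcases eq_or_ne (a - b) 0 with h | h
    · simp [h]
    · rw [Real.sinc_of_ne_zero h, div_mul_cancel₀ _ h]
  rw [mul_assoc, hsinc, Real.sin_sub_sin, ← mul_sub, ← mul_add, mul_div_cancel_left₀ _ two_ne_zero,
    mul_div_cancel_left₀ _ two_ne_zero]
  ring

theorem abs_mul_sin_le {a b c : ℝ} (h : |a| ≤ c) : |a * Real.sin b| ≤ c := by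
  rw [abs_mul]
  exact (mul_le_of_le_one_right (abs_nonneg _) (Real.abs_sin_le_one _)).trans h

theorem lipschitzWith_pruferField {k : ℝ≥0} (hk : ∀ x, |q x| ≤ k) (s t : ℝ) :
    LipschitzWith (2 * k) fun y => s - q t * Real.sin (2 * y) := by
  refine LipschitzWith.of_dist_le_mul fun y z => ?_
  rw [dist_sub_left, Real.dist_eq, Real.dist_eq, ← mul_sub, abs_mul]
  calc |q t| * |Real.sin (2 * y) - Real.sin (2 * z)| ≤ k * (2 * |y - z|) :=
        mul_le_mul (hk t) (abs_sin_two_mul_sub_sin_two_mul_le y z) (abs_nonneg _) k.coe_nonneg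
    _ = (2 * k : ℝ≥0) * |y - z| := by push_cast; ring

theorem exists_isPruferAngle (hL : 0 ≤ L) (hq : Continuous q) {k : ℝ≥0} (hk : ∀ x, |q x| ≤ k)
    (s : ℝ) : ∃ θ, IsPruferAngle L q s θ := by
  obtain ⟨θ, hcont, h0, hderiv⟩ := exists_forall_hasDerivAt_of_lipschitzWith hL
    (f := fun t y => s - q t * Real.sin (2 * y)) (M := ‖s‖₊ + k) (fun y => by fun_prop)
    (lipschitzWith_pruferField hk s)
    (fun t y => (norm_sub_le _ _).trans (add_le_add_right (abs_mul_sin_le (hk t)) _)) 0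
  exact ⟨θ, hcont, h0, hderiv⟩

namespace IsPruferAngle

theorem spectral_le_add (hL : 0 < L) (hq' : Continuous q') (h : IsPruferAngle L q s θ)
    (h' : IsPruferAngle L q' s' θ') (hη : ∀ x ∈ Icc 0 L, |q x - q' x| ≤ η) (hθ : θ L = θ' L) :
    s ≤ s' + η := by
  by_contra! hlt
  have hc := h.continuous
  have hc' := h'.continuous
  have hpos : 0 < θ L - θ' L := by
    refine pos_of_hasDerivAt_sub_mul_self hL (φ := fun x => θ x - θ' x)
      (g := fun x => s - s' - (q x - q' x) * Real.sin (2 * θ x))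
      (h := fun x => 2 * q' x * Real.cos (θ x + θ' x) * Real.sinc (θ x - θ' x)) (by fun_prop)
      (fun x hx => ?_) (by simp [h.apply_zero, h'.apply_zero]) fun x hx => ?_
    · have := le_of_abs_le (abs_mul_sin_le (b := 2 * θ x) (hη x hx))
      linarith
    · convert! (h.hasDerivAt x hx).sub (h'.hasDerivAt x hx) using 1
      linear_combination q' x * sin_two_mul_sub_sin_two_mul (θ x) (θ' x)
  exact hpos.ne' (sub_eq_zero.2 hθ)

theorem abs_spectral_sub_le (hL : 0 < L) (hq : Continuous q) (hq' : Continuous q')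
    (h : IsPruferAngle L q s θ) (h' : IsPruferAngle L q' s' θ')
    (hη : ∀ x ∈ Icc 0 L, |q x - q' x| ≤ η) (hθ : θ L = θ' L) : |s - s'| ≤ η := by
  have hle := h.spectral_le_add hL hq' h' hη hθ
  have hge := h'.spectral_le_add hL hq h (fun x hx => abs_sub_comm (q x) (q' x) ▸ hη x hx) hθ.symm
  rw [abs_le]
  constructor <;> linarith

theorem abs_sub_mul_le (h : IsPruferAngle L q s θ) (hk : ∀ x, |q x| ≤ k) {x : ℝ}
    (hx : x ∈ Icc 0 L) : |θ x - s * x| ≤ k * x := by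
  have hderiv : ∀ y ∈ Icc 0 L,
      HasDerivWithinAt (fun y => θ y - s * y) (-(q y * Real.sin (2 * θ y))) (Icc 0 L) y := by
    intro y hy
    convert! ((h.hasDerivAt y hy).sub ((hasDerivAt_id y).const_mul s)).hasDerivWithinAt using 1
    ring
  have := (convex_Icc 0 L).norm_image_sub_le_of_norm_hasDerivWithin_le hderiv
    (fun y _ => (norm_neg _).trans_le (abs_mul_sin_le (hk y)))
    (left_mem_Icc.2 (hx.1.trans hx.2)) hx
  simpa [h.apply_zero, abs_of_nonneg hx.1] using this

theorem dist_apply_le_gronwallBound (hL : 0 ≤ L) {k : ℝ≥0} (hk : ∀ x, |q x| ≤ k)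
    (h : IsPruferAngle L q s θ) (h' : IsPruferAngle L q s' θ') :
    dist (θ L) (θ' L) ≤ gronwallBound 0 (2 * k : ℝ≥0) (dist s s') L := by
  have := dist_le_of_approx_trajectories_ODE (δ := 0) (εf := 0) (εg := dist s s')
    (lipschitzWith_pruferField hk s) h.continuous.continuousOn
    (fun t ht => (h.hasDerivAt t (Ico_subset_Icc_self ht)).hasDerivWithinAt)
    (fun t _ => (dist_self _).le) h'.continuous.continuousOn
    (fun t ht => (h'.hasDerivAt t (Ico_subset_Icc_self ht)).hasDerivWithinAt)
    (fun t _ => by rw [dist_sub_right, dist_comm]) (by rw [h.apply_zero, h'.apply_zero, dist_self])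
    L (right_mem_Icc.2 hL)
  rwa [sub_zero, zero_add] at this

end IsPruferAngle

theorem exists_isPruferAngle_apply_eq (hL : 0 < L) (hq : Continuous q) {k : ℝ≥0}
    (hk : ∀ x, |q x| ≤ k) (y : ℝ) : ∃ s θ, IsPruferAngle L q s θ ∧ θ L = y := by
  choose Θ hΘ using exists_isPruferAngle hL.le hq hk
  have hcont : Continuous fun s => Θ s L := by
    refine continuous_iff_continuousAt.2 fun s => tendsto_iff_dist_tendsto_zero.2 ?_
    have hbound : Tendsto (fun s' => gronwallBound 0 (2 * k : ℝ≥0) (dist s' s) L) (𝓝 s) (𝓝 0) := by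
      have : Continuous fun s' => gronwallBound 0 (2 * k : ℝ≥0) (dist s' s) L :=
        (gronwallBound_continuous_ε _ _ _).comp (continuous_id.dist continuous_const)
      simpa only [dist_self, gronwallBound_ε0_δ0] using this.tendsto s
    exact squeeze_zero (fun _ => dist_nonneg)
      (fun s' => (hΘ s').dist_apply_le_gronwallBound hL.le hk (hΘ s)) hbound
  have hend : ∀ s, |Θ s L - s * L| ≤ k * L := fun s =>
    (hΘ s).abs_sub_mul_le hk (right_mem_Icc.2 hL.le)
  have hle : Θ (y / L - k) L ≤ y := by
    have := le_of_abs_le (hend (y / L - k))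
    rw [sub_mul, div_mul_cancel₀ _ hL.ne'] at this
    linarith
  have hge : y ≤ Θ (y / L + k) L := by
    have := neg_le_of_abs_le (hend (y / L + k))
    rw [add_mul, div_mul_cancel₀ _ hL.ne'] at this
    linarith
  obtain ⟨s, hs⟩ := mem_range_of_exists_le_of_exists_ge hcont ⟨_, hle⟩ ⟨_, hge⟩
  exact ⟨s, Θ s, hΘ s, hs⟩

end PruferAngle

section Amplitude

/-- The amplitude `r` of the solution `(r e^{iθ}, -r e^{-iθ})`, normalized by `r 0 = 1`, of the
Dirac system `w₁' = i s w₁ + p w₁ - q w₂`, `w₂' = -i s w₂ + p w₂ - q w₁` with Prüfer angle `θ`. -/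
def amplitude (p q θ : ℝ → ℝ) (x : ℝ) : ℝ :=
  Real.exp (∫ t in (0 : ℝ)..x, (p t + q t * Real.cos (2 * θ t)))

variable {L s : ℝ} {p q θ : ℝ → ℝ}

theorem amplitude_pos (p q θ : ℝ → ℝ) (x : ℝ) : 0 < amplitude p q θ x := Real.exp_pos _

theorem amplitude_zero (p q θ : ℝ → ℝ) : amplitude p q θ 0 = 1 := by simp [amplitude]

theorem hasDerivAt_amplitude (hp : Continuous p) (hq : Continuous q) (hθ : Continuous θ) (x : ℝ) :
    HasDerivAt (amplitude p q θ) ((p x + q x * Real.cos (2 * θ x)) * amplitude p q θ x) x := by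
  have hc : Continuous fun t => p t + q t * Real.cos (2 * θ t) := by fun_prop
  rw [mul_comm]
  exact (hc.integral_hasStrictDerivAt 0 x).hasDerivAt.exp

theorem continuous_amplitude (hp : Continuous p) (hq : Continuous q) (hθ : Continuous θ) :
    Continuous (amplitude p q θ) :=
  continuous_iff_continuousAt.2 fun x => (hasDerivAt_amplitude hp hq hθ x).continuousAt

theorem amplitude_eq_exp_integral_mul (hp : Continuous p) (hq : Continuous q) (hθ : Continuous θ)
    (x : ℝ) : amplitude p q θ x = Real.exp (∫ t in (0 : ℝ)..x, p t) * amplitude 0 q θ x := by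
  have hc : Continuous fun t => q t * Real.cos (2 * θ t) := by fun_prop
  simp only [amplitude, Pi.zero_apply, zero_add, ← Real.exp_add]
  rw [intervalIntegral.integral_add (hp.intervalIntegrable _ _) (hc.intervalIntegrable _ _)]

theorem amplitude_neg_mul_amplitude (hp : Continuous p) (hq : Continuous q) (hθ : Continuous θ)
    (x : ℝ) : amplitude (-p) q θ x * amplitude p q θ x = amplitude 0 q θ x ^ 2 := by
  rw [amplitude_eq_exp_integral_mul hp hq hθ, amplitude_eq_exp_integral_mul hp.neg hq hθ,
    mul_mul_mul_comm, ← Real.exp_add]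
  simp [sq]

namespace IsPruferAngle

theorem hasDerivAt_amplitude_mul_cos (h : IsPruferAngle L q s θ) (hp : Continuous p)
    (hq : Continuous q) {x : ℝ} (hx : x ∈ Icc 0 L) :
    HasDerivAt (fun x => amplitude p q θ x * Real.cos (θ x))
      ((p x + q x) * (amplitude p q θ x * Real.cos (θ x)) -
        s * (amplitude p q θ x * Real.sin (θ x))) x := by
  convert! (hasDerivAt_amplitude hp hq h.continuous x).mul (h.hasDerivAt x hx).cos using 1
  rw [Real.cos_two_mul, Real.sin_two_mul]
  linear_combination (-2 * q x * amplitude p q θ x * Real.cos (θ x)) * Real.sin_sq_add_cos_sq (θ x)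

theorem hasDerivAt_amplitude_mul_sin (h : IsPruferAngle L q s θ) (hp : Continuous p)
    (hq : Continuous q) {x : ℝ} (hx : x ∈ Icc 0 L) :
    HasDerivAt (fun x => amplitude p q θ x * Real.sin (θ x))
      ((p x - q x) * (amplitude p q θ x * Real.sin (θ x)) +
        s * (amplitude p q θ x * Real.cos (θ x))) x := by
  convert! (hasDerivAt_amplitude hp hq h.continuous x).mul (h.hasDerivAt x hx).sin using 1
  rw [Real.cos_two_mul, Real.sin_two_mul]
  ring

/-- If `(p + q)' = (q - p) (p + q)`, then `r cos θ - (p + q) r sin θ / s` has derivative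
`-s r sin θ`. -/
theorem mul_integral_amplitude_mul_sin (h : IsPruferAngle L q s θ) (hL : 0 ≤ L) (hs : s ≠ 0)
    (hp : Continuous p) (hq : Continuous q)
    (hpq : ∀ x ∈ Ioo 0 L, HasDerivAt (fun x => p x + q x) ((q x - p x) * (p x + q x)) x)
    (hsin : Real.sin (θ L) = 0) :
    s * ∫ x in (0 : ℝ)..L, amplitude p q θ x * Real.sin (θ x) =
      1 - amplitude p q θ L * Real.cos (θ L) := by
  have hθ := h.continuous
  have hr := continuous_amplitude hp hq hθ
  have hderiv : ∀ x ∈ Ioo 0 L, HasDerivAt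
      (fun x => amplitude p q θ x * Real.cos (θ x) -
        (p x + q x) * (amplitude p q θ x * Real.sin (θ x)) / s)
      (-s * (amplitude p q θ x * Real.sin (θ x))) x := by
    intro x hx
    have hx' := Ioo_subset_Icc_self hx
    convert! (h.hasDerivAt_amplitude_mul_cos hp hq hx').sub
      (((hpq x hx).mul (h.hasDerivAt_amplitude_mul_sin hp hq hx')).div_const s) using 1
    field_simp
    ring
  have := intervalIntegral.integral_eq_sub_of_hasDerivAt_of_le hL (by fun_prop) hderiv
    (Continuous.intervalIntegrable (by fun_prop) _ _)
  rw [intervalIntegral.integral_const_mul, hsin, h.apply_zero, amplitude_zero] at this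
  simp only [Real.cos_zero, Real.sin_zero, mul_zero, zero_div, sub_zero, mul_one] at this
  linarith

theorem integral_amplitude_mul_amplitude_mul_cos_sub_eq_zero {s' : ℝ} {θ' : ℝ → ℝ}
    (h : IsPruferAngle L q s θ) (h' : IsPruferAngle L q s' θ') (hL : 0 ≤ L) (hq : Continuous q)
    (hs : s ≠ s') (hsin : Real.sin (θ L - θ' L) = 0) :
    ∫ x in (0 : ℝ)..L, amplitude 0 q θ x * amplitude 0 q θ' x * Real.cos (θ x - θ' x) = 0 := by
  have hθ := h.continuous
  have hθ' := h'.continuous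
  have hr := continuous_amplitude continuous_zero hq hθ
  have hr' := continuous_amplitude continuous_zero hq hθ'
  have hderiv : ∀ x ∈ Icc 0 L, HasDerivAt
      (fun x => amplitude 0 q θ x * amplitude 0 q θ' x * Real.sin (θ x - θ' x))
      ((s - s') * (amplitude 0 q θ x * amplitude 0 q θ' x * Real.cos (θ x - θ' x))) x := by
    intro x hx
    have hcos := h.hasDerivAt_amplitude_mul_cos continuous_zero hq hx
    have hsin := h.hasDerivAt_amplitude_mul_sin continuous_zero hq hx
    have hcos' := h'.hasDerivAt_amplitude_mul_cos continuous_zero hq hx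
    have hsin' := h'.hasDerivAt_amplitude_mul_sin continuous_zero hq hx
    convert! (hsin.mul hcos').sub (hcos.mul hsin') using 1
    · ext y
      simp only [Real.sin_sub, Pi.sub_apply, Pi.mul_apply]
      ring
    · simp only [Real.cos_sub, Pi.zero_apply]
      ring
  have := intervalIntegral.integral_eq_sub_of_hasDerivAt
    (fun x hx => hderiv x (uIcc_of_le hL ▸ hx)) (Continuous.intervalIntegrable (by fun_prop) _ _)
  rw [intervalIntegral.integral_const_mul, hsin, h.apply_zero, h'.apply_zero, sub_self,
    Real.sin_zero, mul_zero, mul_zero, sub_zero] at this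
  exact (mul_eq_zero.1 this).resolve_left (sub_ne_zero.2 hs)

end IsPruferAngle

end Amplitude

section Oscillation

/-- The oscillatory integral `∫₀ˣ q e^{2iθ}`. Its real and imaginary parts govern the deviation of
the amplitude and of the Prüfer angle from those of the free system `q = 0`. -/
def oscillation (q θ : ℝ → ℝ) (x : ℝ) : ℂ :=
  ∫ t in (0 : ℝ)..x, (q t : ℂ) * Complex.exp ((2 * θ t : ℝ) * Complex.I)

/-- A real coupling coefficient on `[0, L]` which is small and slowly varying: it is bounded by `k`
and its derivative on `[0, L]` by `2 k ^ 2`. Outside `[0, L]` its values only matter for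
convenience: continuity and the bound are required on the whole line. -/
structure IsCoupling (L k : ℝ) (q : ℝ → ℝ) : Prop where
  continuous : Continuous q
  abs_le : ∀ x, |q x| ≤ k
  exists_hasDerivWithinAt : ∀ x ∈ Icc 0 L,
    ∃ q', HasDerivWithinAt q q' (Icc 0 L) x ∧ |q'| ≤ 2 * k ^ 2

variable {L k s : ℝ} {q θ : ℝ → ℝ}

theorem IsCoupling.nonneg (h : IsCoupling L k q) : 0 ≤ k := (abs_nonneg _).trans (h.abs_le 0)

theorem continuous_mul_cexp_two_mul (hq : Continuous q) (hθ : Continuous θ) :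
    Continuous fun t => (q t : ℂ) * Complex.exp ((2 * θ t : ℝ) * Complex.I) := by fun_prop

theorem re_oscillation (hq : Continuous q) (hθ : Continuous θ) (x : ℝ) :
    (oscillation q θ x).re = ∫ t in (0 : ℝ)..x, q t * Real.cos (2 * θ t) := by
  rw [oscillation, ← Complex.reCLM_apply, ← Complex.reCLM.intervalIntegral_comp_comm
    ((continuous_mul_cexp_two_mul hq hθ).intervalIntegrable _ _)]
  simp only [Complex.reCLM_apply, Complex.re_ofReal_mul, Complex.exp_ofReal_mul_I_re]

theorem im_oscillation (hq : Continuous q) (hθ : Continuous θ) (x : ℝ) :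
    (oscillation q θ x).im = ∫ t in (0 : ℝ)..x, q t * Real.sin (2 * θ t) := by
  rw [oscillation, ← Complex.imCLM_apply, ← Complex.imCLM.intervalIntegral_comp_comm
    ((continuous_mul_cexp_two_mul hq hθ).intervalIntegrable _ _)]
  simp only [Complex.imCLM_apply, Complex.im_ofReal_mul, Complex.exp_ofReal_mul_I_im]

theorem amplitude_zero_left (hq : Continuous q) (hθ : Continuous θ) (x : ℝ) :
    amplitude 0 q θ x = Real.exp (oscillation q θ x).re := by
  simp only [amplitude, re_oscillation hq hθ, Pi.zero_apply, zero_add]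

theorem norm_oscillation_le (hk : ∀ x, |q x| ≤ k) {x : ℝ} (hx : 0 ≤ x) :
    ‖oscillation q θ x‖ ≤ k * x := by
  have := intervalIntegral.norm_integral_le_of_norm_le_const (a := 0) (b := x) (C := k)
    (f := fun t => (q t : ℂ) * Complex.exp ((2 * θ t : ℝ) * Complex.I)) fun t _ => by
      rw [norm_mul, Complex.norm_exp_ofReal_mul_I, mul_one, Complex.norm_real]
      exact hk t
  rwa [sub_zero, abs_of_nonneg hx] at this

namespace IsPruferAngle

theorem sub_mul_eq_neg_im_oscillation (h : IsPruferAngle L q s θ) (hq : Continuous q) {x : ℝ}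
    (hx : x ∈ Icc 0 L) : θ x - s * x = -(oscillation q θ x).im := by
  have hθ := h.continuous
  have hsin : Continuous fun t => q t * Real.sin (2 * θ t) := by fun_prop
  have hFTC := intervalIntegral.integral_eq_sub_of_hasDerivAt
    (fun t ht => h.hasDerivAt t (Icc_subset_Icc_right hx.2 (uIcc_of_le hx.1 ▸ ht)))
    ((continuous_const.sub hsin).intervalIntegrable _ _)
  rw [intervalIntegral.integral_sub (continuous_const.intervalIntegrable _ _)
    (hsin.intervalIntegrable _ _), intervalIntegral.integral_const, ← im_oscillation hq hθ,
    h.apply_zero, smul_eq_mul] at hFTC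
  linarith

theorem hasDerivWithinAt_sub_oscillation (h : IsPruferAngle L q s θ) (hq : Continuous q) {x q' : ℝ}
    (hx : x ∈ Icc 0 L) (hq' : HasDerivWithinAt q q' (Icc 0 L) x) :
    HasDerivWithinAt
      (fun x => (q x : ℂ) * Complex.exp ((2 * θ x : ℝ) * Complex.I) -
        2 * s * Complex.I * oscillation q θ x)
      ((q' - 2 * (q x ^ 2 * Real.sin (2 * θ x) : ℝ) * Complex.I) *
        Complex.exp ((2 * θ x : ℝ) * Complex.I)) (Icc 0 L) x := by
  have hexp := ((((h.hasDerivAt x hx).const_mul 2).ofReal_comp).mul_const Complex.I).cexp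
  have hosc := ((continuous_mul_cexp_two_mul hq h.continuous).integral_hasStrictDerivAt
    0 x).hasDerivAt
  convert! (hq'.ofReal_comp.mul hexp.hasDerivWithinAt).sub
    (hosc.const_mul (2 * s * Complex.I)).hasDerivWithinAt using 1
  push_cast
  ring

theorem abs_mul_norm_oscillation_le (h : IsPruferAngle L q s θ) (hq : IsCoupling L k q) {x : ℝ}
    (hx : x ∈ Icc 0 L) : |s| * ‖oscillation q θ x‖ ≤ k + 2 * k ^ 2 * x := by
  choose! q' hq' hq'k using hq.exists_hasDerivWithinAt
  let g : ℝ → ℂ := fun y => (q y : ℂ) * Complex.exp ((2 * θ y : ℝ) * Complex.I)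
  have hg : ∀ y, ‖g y‖ ≤ k := fun y => by
    rw [norm_mul, Complex.norm_exp_ofReal_mul_I, mul_one, Complex.norm_real]
    exact hq.abs_le y
  have hderiv : ∀ y ∈ Icc 0 L, ‖((q' y : ℂ) - 2 * (q y ^ 2 * Real.sin (2 * θ y) : ℝ) * Complex.I) *
      Complex.exp ((2 * θ y : ℝ) * Complex.I)‖ ≤ 4 * k ^ 2 := fun y hy => by
    have hsq : |q y ^ 2 * Real.sin (2 * θ y)| ≤ k ^ 2 :=
      abs_mul_sin_le (by rw [abs_pow]; exact pow_le_pow_left₀ (abs_nonneg _) (hq.abs_le y) 2)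
    rw [norm_mul, Complex.norm_exp_ofReal_mul_I, mul_one]
    refine (norm_sub_le _ _).trans ?_
    rw [norm_mul, norm_mul, Complex.norm_I, mul_one, Complex.norm_ofNat, Complex.norm_real,
      Complex.norm_real, Real.norm_eq_abs, Real.norm_eq_abs]
    linarith [hq'k y hy]
  have hmvt : ‖g x - 2 * s * Complex.I * oscillation q θ x - g 0‖ ≤ 4 * k ^ 2 * x := by
    simpa only [oscillation, intervalIntegral.integral_same, mul_zero, sub_zero,
      Real.norm_of_nonneg hx.1] using
      (convex_Icc 0 L).norm_image_sub_le_of_norm_hasDerivWithin_le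
        (fun y hy => h.hasDerivWithinAt_sub_oscillation hq.continuous hy (hq' y hy)) hderiv
        (left_mem_Icc.2 (hx.1.trans hx.2)) hx
  have hosc : ‖2 * s * Complex.I * oscillation q θ x‖ ≤ k + k + 4 * k ^ 2 * x :=
    calc ‖2 * s * Complex.I * oscillation q θ x‖
        = ‖g x - g 0 - (g x - 2 * s * Complex.I * oscillation q θ x - g 0)‖ := by
          congr 1
          ring
      _ ≤ k + k + 4 * k ^ 2 * x := (norm_sub_le _ _).trans
          (add_le_add ((norm_sub_le _ _).trans (add_le_add (hg x) (hg 0))) hmvt)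
  simp only [norm_mul, Complex.norm_I, mul_one, Complex.norm_ofNat, Complex.norm_real,
    Real.norm_eq_abs] at hosc
  linarith

end IsPruferAngle

end Oscillation

section QuantizedAngle

/-- The Prüfer angle `π n x / L` of the unperturbed eigenfunction `psi0 L n`. -/
def phase (L : ℝ) (n : ℤ) (x : ℝ) : ℝ := Real.pi * n / L * x

variable {L k s x : ℝ} {p q θ : ℝ → ℝ} {n : ℤ}

theorem continuous_phase (L : ℝ) (n : ℤ) : Continuous (phase L n) := continuous_const_mul _

namespace IsPruferAngle

theorem spectral_sub_mul_eq (h : IsPruferAngle L q s θ) (hL : 0 < L) (hq : Continuous q)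
    (hn : θ L = Real.pi * n) : (s - Real.pi * n / L) * L = (oscillation q θ L).im := by
  have := h.sub_mul_eq_neg_im_oscillation hq (right_mem_Icc.2 hL.le)
  rw [sub_mul, div_mul_cancel₀ _ hL.ne', ← hn]
  linarith

theorem abs_spectral_sub_le_coupling (h : IsPruferAngle L q s θ) (hL : 0 < L) (hk : ∀ x, |q x| ≤ k)
    (hn : θ L = Real.pi * n) : |s - Real.pi * n / L| ≤ k := by
  have hend := h.abs_sub_mul_le hk (right_mem_Icc.2 hL.le)
  have : θ L - s * L = -((s - Real.pi * n / L) * L) := by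
    rw [sub_mul, div_mul_cancel₀ _ hL.ne', hn]
    ring
  rw [this, abs_neg, abs_mul, abs_of_pos hL] at hend
  exact le_of_mul_le_mul_right hend hL

theorem pi_mul_abs_sub_le (h : IsPruferAngle L q s θ) (hL : 0 < L) (hk : ∀ x, |q x| ≤ k)
    (hn : θ L = Real.pi * n) : Real.pi * |(n : ℝ)| - k * L ≤ |s| * L := by
  have hend := h.abs_sub_mul_le hk (right_mem_Icc.2 hL.le)
  have := abs_sub_abs_le_abs_sub (θ L) (s * L)
  rw [hn, abs_mul, abs_mul, abs_of_pos Real.pi_pos, abs_of_pos hL, ← hn] at this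
  linarith

/-- Integrating by parts gains the factor `1 / |n|`, because `q` varies slowly. -/
theorem norm_oscillation_le_div_sqrt (h : IsPruferAngle L q s θ) (hL : 0 < L)
    (hq : IsCoupling L k q) (hkL : k * L ≤ 1 / 1000) (hn : θ L = Real.pi * n) (hx : x ∈ Icc 0 L) :
    ‖oscillation q θ x‖ ≤ k * L / √(1 + n ^ 2) := by
  have hk := hq.nonneg
  have hkL0 := mul_nonneg hk hL.le
  have htriv : ‖oscillation q θ x‖ ≤ k * L :=
    (norm_oscillation_le hq.abs_le hx.1).trans (mul_le_mul_of_nonneg_left hx.2 hk)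
  rcases eq_or_ne n 0 with rfl | hn0
  · simpa using htriv
  have hosc := h.abs_mul_norm_oscillation_le hq hx
  have hs := h.pi_mul_abs_sub_le hL hq.abs_le hn
  have hn1 : (1 : ℝ) ≤ |(n : ℝ)| := by exact_mod_cast Int.one_le_abs hn0
  have hsqrt : √(1 + (n : ℝ) ^ 2) ≤ 2 * |(n : ℝ)| := by
    rw [← sq_abs, Real.sqrt_le_left (by linarith)]
    nlinarith
  have hcomb : (Real.pi * |(n : ℝ)| - k * L) * ‖oscillation q θ x‖ ≤ k * L * (1 + 2 * (k * L)) :=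
    calc (Real.pi * |(n : ℝ)| - k * L) * ‖oscillation q θ x‖
        ≤ |s| * L * ‖oscillation q θ x‖ := mul_le_mul_of_nonneg_right hs (norm_nonneg _)
      _ = |s| * ‖oscillation q θ x‖ * L := by ring
      _ ≤ (k + 2 * k ^ 2 * x) * L := mul_le_mul_of_nonneg_right hosc hL.le
      _ ≤ (k + 2 * k ^ 2 * L) * L := by gcongr; exact hx.2
      _ = k * L * (1 + 2 * (k * L)) := by ring
  rw [le_div_iff₀ (by positivity)]
  calc ‖oscillation q θ x‖ * √(1 + n ^ 2) ≤ ‖oscillation q θ x‖ * (2 * |(n : ℝ)|) := by gcongr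
    _ ≤ k * L := by
      have hpi := mul_le_mul_of_nonneg_right Real.pi_gt_three.le (abs_nonneg (n : ℝ))
      have : (2.9 * |(n : ℝ)|) * ‖oscillation q θ x‖ ≤ k * L * 1.002 :=
        (mul_le_mul_of_nonneg_right (by linarith) (norm_nonneg _)).trans
          (hcomb.trans (mul_le_mul_of_nonneg_left (by linarith) hkL0))
      linarith

theorem abs_sub_phase_le (h : IsPruferAngle L q s θ) (hL : 0 < L)
    (hq : IsCoupling L k q) (hkL : k * L ≤ 1 / 1000) (hn : θ L = Real.pi * n) (hx : x ∈ Icc 0 L) :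
    |θ x - phase L n x| ≤ 2 * (k * L / √(1 + n ^ 2)) := by
  have hspec : |(s - Real.pi * n / L) * x| ≤ ‖oscillation q θ L‖ :=
    calc |(s - Real.pi * n / L) * x| ≤ |(s - Real.pi * n / L) * L| := by
          rw [abs_mul, abs_mul, abs_of_nonneg hx.1, abs_of_pos hL]
          gcongr
          exact hx.2
      _ ≤ ‖oscillation q θ L‖ := by
          rw [h.spectral_sub_mul_eq hL hq.continuous hn]
          exact Complex.abs_im_le_norm _
  have hangle : |θ x - s * x| ≤ ‖oscillation q θ x‖ := by
    rw [h.sub_mul_eq_neg_im_oscillation hq.continuous hx, abs_neg]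
    exact Complex.abs_im_le_norm _
  have hx' := h.norm_oscillation_le_div_sqrt hL hq hkL hn hx
  have hL' := h.norm_oscillation_le_div_sqrt hL hq hkL hn (right_mem_Icc.2 hL.le)
  calc |θ x - phase L n x| = |(θ x - s * x) + (s - Real.pi * n / L) * x| := by
        rw [phase]
        ring_nf
    _ ≤ 2 * (k * L / √(1 + n ^ 2)) := (abs_add_le _ _).trans (by linarith)

theorem abs_amplitude_zero_left_sub_one_le (h : IsPruferAngle L q s θ) (hL : 0 < L)
    (hq : IsCoupling L k q) (hkL : k * L ≤ 1 / 1000) (hn : θ L = Real.pi * n) (hx : x ∈ Icc 0 L) :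
    |amplitude 0 q θ x - 1| ≤ 2 * (k * L / √(1 + n ^ 2)) := by
  have hk := hq.nonneg
  have hosc := (Complex.abs_re_le_norm _).trans (h.norm_oscillation_le_div_sqrt hL hq hkL hn hx)
  have hle : k * L / √(1 + (n : ℝ) ^ 2) ≤ k * L :=
    div_le_self (mul_nonneg hk hL.le) (Real.one_le_sqrt.2 (by nlinarith))
  rw [amplitude_zero_left hq.continuous h.continuous]
  exact (Real.abs_exp_sub_one_le (by linarith)).trans (mul_le_mul_of_nonneg_left hosc zero_le_two)

end IsPruferAngle

theorem abs_amplitude_sub_one_le {c : ℝ} (hp : ∀ x, |p x| ≤ c) (hq : ∀ x, |q x| ≤ k)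
    (hx : x ∈ Icc 0 L) (hc : (c + k) * L ≤ 1) :
    |amplitude p q θ x - 1| ≤ 2 * ((c + k) * L) := by
  have hlog : |∫ t in (0 : ℝ)..x, (p t + q t * Real.cos (2 * θ t))| ≤ (c + k) * L := by
    have := intervalIntegral.norm_integral_le_of_norm_le_const (a := 0) (b := x) (C := c + k)
      (f := fun t => p t + q t * Real.cos (2 * θ t)) fun t _ =>
        (abs_add_le _ _).trans (add_le_add (hp t) ((abs_mul _ _).trans_le
          ((mul_le_of_le_one_right (abs_nonneg _) (Real.abs_cos_le_one _)).trans (hq t))))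
    rw [sub_zero, abs_of_nonneg hx.1] at this
    have hck : 0 ≤ c + k := add_nonneg ((abs_nonneg _).trans (hp 0)) ((abs_nonneg _).trans (hq 0))
    exact this.trans (mul_le_mul_of_nonneg_left hx.2 hck)
  exact (Real.abs_exp_sub_one_le (hlog.trans hc)).trans (mul_le_mul_of_nonneg_left hlog zero_le_two)

end QuantizedAngle

section Polar

/-- The function `(r e^{iθ}, -r e^{-iθ})`. -/
def polar (r θ : ℝ → ℝ) (x : ℝ) : C2 :=
  !₂[r x * Complex.exp (θ x * Complex.I), -conj (r x * Complex.exp (θ x * Complex.I))]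

variable {r θ : ℝ → ℝ} {x : ℝ}

theorem polar_apply_zero (r θ : ℝ → ℝ) (x : ℝ) :
    polar r θ x 0 = r x * Complex.exp (θ x * Complex.I) := rfl

theorem polar_apply_one (r θ : ℝ → ℝ) (x : ℝ) :
    polar r θ x 1 = -conj (r x * Complex.exp (θ x * Complex.I)) := rfl

theorem psi0_eq_polar (L : ℝ) (n : ℤ) : psi0 L n = polar 1 (phase L n) := by
  have harg : ∀ x : ℝ, Complex.I * Real.pi * n * x / L = (phase L n x : ℂ) * Complex.I := by
    intro x
    simp only [phase]
    push_cast
    ring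
  ext x i
  fin_cases i <;> simp [psi0, polar, harg, ← Complex.exp_conj]

theorem continuous_polar (hr : Continuous r) (hθ : Continuous θ) : Continuous (polar r θ) := by
  unfold polar
  fun_prop

theorem polar_apply_zero_ne_zero (hr : r x ≠ 0) : polar r θ x 0 ≠ 0 :=
  mul_ne_zero (Complex.ofReal_ne_zero.2 hr) (Complex.exp_ne_zero _)

theorem polar_apply_zero_eq_neg_iff (hr : r x ≠ 0) :
    polar r θ x 0 = -polar r θ x 1 ↔ Real.sin (θ x) = 0 := by
  rw [polar_apply_zero, polar_apply_one, neg_neg, eq_comm, Complex.conj_eq_iff_im,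
    Complex.im_ofReal_mul, Complex.exp_ofReal_mul_I_im, mul_eq_zero, or_iff_right hr]

theorem pairing_smul_polar (L : ℝ) (α β : ℂ) (r θ r' θ' : ℝ → ℝ) :
    pairing L (fun x => α • polar r θ x) (fun x => β • polar r' θ' x) =
      α * conj β * (1 / L * ∫ x in (0 : ℝ)..L, r x * r' x * Real.cos (θ x - θ' x) : ℝ) := by
  have hre : ∀ x, ((r x * Complex.exp (θ x * Complex.I)) *
      conj (r' x * Complex.exp (θ' x * Complex.I))).re = r x * r' x * Real.cos (θ x - θ' x) := by
    intro x
    simp only [map_mul, Complex.mul_re, Complex.mul_im, Complex.conj_re, Complex.conj_im,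
      Complex.ofReal_re, Complex.ofReal_im, Complex.exp_ofReal_mul_I_re,
      Complex.exp_ofReal_mul_I_im, Real.cos_sub]
    ring
  have hpoint : ∀ x, (α • polar r θ x) 0 * conj ((β • polar r' θ' x) 0) +
      (α • polar r θ x) 1 * conj ((β • polar r' θ' x) 1) =
      2 * (α * conj β) * (r x * r' x * Real.cos (θ x - θ' x) : ℝ) := by
    intro x
    rw [← hre, Complex.re_eq_add_conj]
    simp only [PiLp.smul_apply, smul_eq_mul, polar_apply_zero, polar_apply_one, map_mul, map_neg,
      Complex.conj_conj]
    ring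
  simp only [pairing, hpoint]
  rw [intervalIntegral.integral_const_mul, intervalIntegral.integral_ofReal]
  push_cast
  ring

theorem pairing_smul_polar_controlProfile (L : ℝ) (β : ℂ) (r θ : ℝ → ℝ) :
    pairing L (fun x => β • polar r θ x) controlProfile =
      β * Complex.I * (1 / L * ∫ x in (0 : ℝ)..L, r x * Real.sin (θ x) : ℝ) := by
  have hpoint : ∀ x, (β • polar r θ x) 0 * conj (controlProfile x 0) +
      (β • polar r θ x) 1 * conj (controlProfile x 1) =
      2 * (β * Complex.I) * (r x * Real.sin (θ x) : ℝ) := by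
    intro x
    have hsub := Complex.sub_conj (r x * Complex.exp (θ x * Complex.I))
    rw [Complex.im_ofReal_mul, Complex.exp_ofReal_mul_I_im] at hsub
    simp only [controlProfile, PiLp.smul_apply, smul_eq_mul, polar_apply_zero, polar_apply_one,
      Matrix.cons_val_zero, Matrix.cons_val_one, map_one]
    push_cast at hsub ⊢
    linear_combination β * hsub
  simp only [pairing, hpoint]
  rw [intervalIntegral.integral_const_mul, intervalIntegral.integral_ofReal]
  push_cast
  ring

theorem pairing_congr {L : ℝ} (hL : 0 ≤ L) {f f' g g' : ℝ → C2} (hf : ∀ x ∈ Icc 0 L, f x = f' x)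
    (hg : ∀ x ∈ Icc 0 L, g x = g' x) : pairing L f g = pairing L f' g' := by
  rw [pairing, pairing]
  congr 1
  refine intervalIntegral.integral_congr fun x hx => ?_
  rw [uIcc_of_le hL] at hx
  simp only [hf x hx, hg x hx]

theorem conj_pairing (L : ℝ) (f g : ℝ → C2) : conj (pairing L f g) = pairing L g f := by
  simp only [pairing, intervalIntegral, map_mul, map_sub, ← integral_conj]
  simp [mul_comm, map_ofNat (starRingEnd ℂ) 2]

theorem norm_ofReal_mul_cexp_sub_cexp_le (a b c : ℝ) :
    ‖(a : ℂ) * Complex.exp (b * Complex.I) - Complex.exp (c * Complex.I)‖ ≤ |a - 1| + |b - c| := by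
  have hsplit : (a : ℂ) * Complex.exp (b * Complex.I) - Complex.exp (c * Complex.I) =
      ((a - 1 : ℝ) : ℂ) * Complex.exp (b * Complex.I) +
        Complex.exp (c * Complex.I) * (Complex.exp (Complex.I * (b - c : ℝ)) - 1) := by
    rw [mul_sub (Complex.exp _), ← Complex.exp_add]
    push_cast
    ring_nf
  rw [hsplit]
  refine (norm_add_le _ _).trans (add_le_add ?_ ?_)
  · rw [norm_mul, Complex.norm_exp_ofReal_mul_I, mul_one, Complex.norm_real, Real.norm_eq_abs]
  · rw [norm_mul, Complex.norm_exp_ofReal_mul_I, one_mul]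
    exact Real.norm_exp_I_mul_ofReal_sub_one_le

theorem norm_polar_sub_polar_one_sq_le (r θ φ : ℝ → ℝ) (x : ℝ) :
    ‖polar r θ x - polar 1 φ x‖ ^ 2 ≤ 2 * (|r x - 1| + |θ x - φ x|) ^ 2 := by
  have hle := pow_le_pow_left₀ (norm_nonneg _)
    (norm_ofReal_mul_cexp_sub_cexp_le (r x) (θ x) (φ x)) 2
  rw [EuclideanSpace.norm_sq_eq, Fin.sum_univ_two]
  simp only [PiLp.sub_apply, polar_apply_zero, polar_apply_one, Pi.one_apply, Complex.ofReal_one,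
    one_mul]
  rw [neg_sub_neg, ← map_sub, RCLike.norm_conj, norm_sub_rev (Complex.exp _)]
  linarith

end Polar

section SquareIntegrable

theorem memLp_restrict_Ioo_of_continuousOn {E : Type*} [NormedAddCommGroup E]
    [SecondCountableTopology E] {f : ℝ → E} {a b : ℝ} (hf : ContinuousOn f (Icc a b)) (p : ℝ≥0∞) :
    MemLp f p (volume.restrict (Ioo a b)) := by
  obtain ⟨C, hC⟩ := isCompact_Icc.exists_bound_of_continuousOn hf
  refine MemLp.of_bound
    ((hf.mono Ioo_subset_Icc_self).aestronglyMeasurable measurableSet_Ioo) C ?_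
  filter_upwards [ae_restrict_mem measurableSet_Ioo] with x hx
  exact hC x (Ioo_subset_Icc_self hx)

theorem norm_toLp_sq_eq_integral {α E : Type*} [MeasurableSpace α] {μ : Measure α}
    [NormedAddCommGroup E] [InnerProductSpace ℂ E] {f : α → E} (hf : MemLp f 2 μ) :
    ‖hf.toLp f‖ ^ 2 = ∫ x, ‖f x‖ ^ 2 ∂μ := by
  have hinner : inner ℂ (hf.toLp f) (hf.toLp f) = ((∫ x, ‖f x‖ ^ 2 ∂μ : ℝ) : ℂ) := by
    rw [L2.inner_def, ← integral_complex_ofReal]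
    refine integral_congr_ae ?_
    filter_upwards [hf.coeFn_toLp] with x hx
    rw [hx, inner_self_eq_norm_sq_to_K]
    simp
  rw [inner_self_eq_norm_sq_to_K] at hinner
  exact Complex.ofReal_injective (by simpa using hinner)

variable {L : ℝ}

theorem norm_toLp_sq_le_mul {E : Type*} [NormedAddCommGroup E] [InnerProductSpace ℂ E]
    (hL : 0 ≤ L) {C : ℝ} {f : ℝ → E} (hf : MemLp f 2 (volume.restrict (Ioo 0 L)))
    (hC : ∀ x ∈ Ioo 0 L, ‖f x‖ ^ 2 ≤ C) : ‖hf.toLp f‖ ^ 2 ≤ C * L := by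
  rw [norm_toLp_sq_eq_integral]
  have := setIntegral_mono_on (μ := volume) (s := Ioo 0 L)
    ((memLp_two_iff_integrable_sq_norm hf.1).1 hf) (integrable_const C) measurableSet_Ioo hC
  simpa [hL, mul_comm] using this

theorem inner_toLp_toLp (hL : 0 < L) {f g : ℝ → C2}
    (hf : MemLp f 2 (volume.restrict (Ioo 0 L))) (hg : MemLp g 2 (volume.restrict (Ioo 0 L))) :
    inner ℂ (hf.toLp f) (hg.toLp g) = 2 * L * pairing L g f := by
  rw [L2.inner_def, pairing, intervalIntegral.integral_of_le hL.le, integral_Ioc_eq_integral_Ioo,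
    ← mul_assoc, mul_one_div_cancel (by exact_mod_cast (by positivity : (2 * L : ℝ) ≠ 0)), one_mul]
  refine integral_congr_ae ?_
  filter_upwards [hf.coeFn_toLp, hg.coeFn_toLp] with x hfx hgx
  rw [hfx, hgx, PiLp.inner_apply, Fin.sum_univ_two]
  simp

end SquareIntegrable

section Parseval

variable {L : ℝ} {F : ℝ → C2}

/-- The scalar function on `(-L, L)` equal to `F₁(x)` for `x > 0` and to `-F₂(-x)` for `x < 0`. It
turns the functions `psi0 L n` into the Fourier monomials `exp (iπnx/L)`. -/
def unfolding (F : ℝ → C2) (x : ℝ) : ℂ := if 0 < x then F x 0 else -F (-x) 1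

theorem unfolding_of_pos {x : ℝ} (hx : 0 < x) : unfolding F x = F x 0 := if_pos hx

theorem unfolding_neg_of_pos {x : ℝ} (hx : 0 < x) : unfolding F (-x) = -F x 1 := by
  rw [unfolding, if_neg (by linarith), neg_neg]

theorem intervalIntegrable_and_integral_comp_unfolding {E : Type*} [NormedAddCommGroup E]
    [NormedSpace ℝ E] (hL : 0 ≤ L) (Φ : ℝ → ℂ → E)
    (h0 : IntervalIntegrable (fun x => Φ x (F x 0)) volume 0 L)
    (h1 : IntervalIntegrable (fun x => Φ (-x) (-F x 1)) volume 0 L) :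
    IntervalIntegrable (fun x => Φ x (unfolding F x)) volume (-L) L ∧
      ∫ x in -L..L, Φ x (unfolding F x) =
        ∫ x in (0 : ℝ)..L, (Φ x (F x 0) + Φ (-x) (-F x 1)) := by
  have hright : ∀ x ∈ uIoc 0 L, Φ x (F x 0) = Φ x (unfolding F x) := fun x hx => by
    rw [unfolding_of_pos (uIoc_of_le hL ▸ hx).1]
  have hleft : ∀ x ∈ uIoc 0 L, Φ (-x) (-F x 1) = Φ (-x) (unfolding F (-x)) := fun x hx => by
    rw [unfolding_neg_of_pos (uIoc_of_le hL ▸ hx).1]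
  have hpos := h0.congr hright
  have hneg : IntervalIntegrable (fun x => Φ x (unfolding F x)) volume (-L) 0 := by
    have := ((h1.congr hleft).comp_sub_left 0).symm
    simpa using this
  refine ⟨hneg.trans hpos, ?_⟩
  rw [← intervalIntegral.integral_add_adjacent_intervals hneg hpos,
    intervalIntegral.integral_add h0 h1, add_comm,
    intervalIntegral.integral_congr_ae (ae_of_all _ hright),
    intervalIntegral.integral_congr_ae (ae_of_all _ hleft),
    intervalIntegral.integral_comp_neg fun x => Φ x (unfolding F x), neg_zero]

theorem memLp_apply (hF : MemLp F 2 (volume.restrict (Ioo 0 L))) (i : Fin 2) :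
    MemLp (fun x => F x i) 2 (volume.restrict (Ioo 0 L)) :=
  ContinuousLinearMap.comp_memLp' (EuclideanSpace.proj (𝕜 := ℂ) i) hF

theorem intervalIntegrable_norm_sq_apply (hL : 0 ≤ L)
    (hF : MemLp F 2 (volume.restrict (Ioo 0 L))) (i : Fin 2) :
    IntervalIntegrable (fun x => ‖F x i‖ ^ 2) volume 0 L :=
  (intervalIntegrable_iff_integrableOn_Ioo_of_le hL).2
    ((memLp_two_iff_integrable_sq_norm (memLp_apply hF i).1).1 (memLp_apply hF i))

theorem integral_norm_unfolding_sq (hL : 0 ≤ L) (hF : MemLp F 2 (volume.restrict (Ioo 0 L))) :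
    ∫ x in -L..L, ‖unfolding F x‖ ^ 2 = ‖hF.toLp F‖ ^ 2 := by
  rw [(intervalIntegrable_and_integral_comp_unfolding hL (fun _ z => ‖z‖ ^ 2)
    (intervalIntegrable_norm_sq_apply hL hF 0)
    (by simpa using intervalIntegrable_norm_sq_apply hL hF 1)).2, norm_toLp_sq_eq_integral,
    intervalIntegral.integral_of_le hL, integral_Ioc_eq_integral_Ioo]
  simp [EuclideanSpace.norm_sq_eq]

theorem memLp_unfolding (hL : 0 ≤ L) (hFm : StronglyMeasurable F)
    (hF : MemLp F 2 (volume.restrict (Ioo 0 L))) :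
    MemLp (unfolding F) 2 (volume.restrict (Ioc (-L) L)) := by
  have happly : ∀ i, StronglyMeasurable fun x => F x i := fun i =>
    (EuclideanSpace.proj (𝕜 := ℂ) i).continuous.comp_stronglyMeasurable hFm
  have hmeas : StronglyMeasurable (unfolding F) :=
    (happly 0).ite measurableSet_Ioi ((happly 1).comp_measurable measurable_neg).neg
  rw [memLp_two_iff_integrable_sq_norm hmeas.aestronglyMeasurable]
  exact (intervalIntegrable_iff_integrableOn_Ioc_of_le (by linarith)).1
    (intervalIntegrable_and_integral_comp_unfolding hL (fun _ z => ‖z‖ ^ 2)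
      (intervalIntegrable_norm_sq_apply hL hF 0)
      (by simpa using intervalIntegrable_norm_sq_apply hL hF 1)).1

theorem fourierCoeffOn_unfolding (hL : 0 < L) (hF : MemLp F 2 (volume.restrict (Ioo 0 L)))
    (n : ℤ) : fourierCoeffOn (neg_lt_self hL) (unfolding F) n = pairing L F (psi0 L n) := by
  have hmul : ∀ {f g : ℝ → ℂ}, Continuous g → MemLp f 2 (volume.restrict (Ioo 0 L)) →
      IntervalIntegrable (fun x => g x * f x) volume 0 L := fun hg hf =>
    ((intervalIntegrable_iff_integrableOn_Ioo_of_le hL.le).2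
      (hf.integrable (by norm_num))).continuousOn_mul hg.continuousOn
  have hker : ∀ x : ℝ, (fourier (-n) (x : AddCircle (L - -L)) : ℂ) =
      conj (Complex.exp (phase L n x * Complex.I)) := by
    intro x
    have : (L : ℂ) ≠ 0 := by exact_mod_cast hL.ne'
    rw [fourier_coe_apply, ← Complex.exp_conj, phase, map_mul, Complex.conj_ofReal, Complex.conj_I]
    congr 1
    push_cast
    rw [show (L : ℂ) - -L = 2 * L by ring]
    field_simp
  have hcont : Continuous fun x => conj (Complex.exp (phase L n x * Complex.I)) := by
    unfold phase
    fun_prop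
  rw [fourierCoeffOn_eq_integral, pairing]
  simp only [hker, smul_eq_mul]
  rw [(intervalIntegrable_and_integral_comp_unfolding hL.le
    (fun x z => conj (Complex.exp (phase L n x * Complex.I)) * z) (hmul hcont (memLp_apply hF 0))
    (hmul (hcont.comp continuous_neg) (memLp_apply hF 1).neg)).2, Complex.real_smul, sub_neg_eq_add,
    ← two_mul]
  push_cast
  congr 1
  refine intervalIntegral.integral_congr fun x _ => ?_
  simp only [psi0_eq_polar, polar_apply_zero, polar_apply_one, Pi.one_apply, Complex.ofReal_one,
    one_mul, map_neg, ← Complex.exp_conj, map_mul, Complex.conj_ofReal, Complex.conj_I, phase,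
    mul_neg]
  push_cast
  ring_nf

theorem hasSum_norm_inner_psi0_sq (hL : 0 < L)
    (hp : ∀ n, MemLp (psi0 L n) 2 (volume.restrict (Ioo 0 L))) (f : L2Space L) :
    HasSum (fun n => ‖inner ℂ ((hp n).toLp (psi0 L n)) f‖ ^ 2) (2 * L * ‖f‖ ^ 2) := by
  have hf := Lp.memLp f
  have hcoeff : ∀ n, ‖inner ℂ ((hp n).toLp (psi0 L n)) f‖ ^ 2 =
      (2 * L) ^ 2 * ‖fourierCoeffOn (neg_lt_self hL) (unfolding f) n‖ ^ 2 := by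
    intro n
    conv_lhs => rw [← Lp.toLp_coeFn f hf]
    rw [inner_toLp_toLp hL, ← fourierCoeffOn_unfolding hL hf, norm_mul, mul_pow]
    simp [abs_of_pos hL]
  have hsum := (hasSum_sq_fourierCoeffOn (neg_lt_self hL)
    (memLp_unfolding hL.le (Lp.stronglyMeasurable f) hf)).mul_left ((2 * L) ^ 2)
  rw [integral_norm_unfolding_sq hL.le hf, Lp.toLp_coeFn, smul_eq_mul] at hsum
  have hscale : (2 * L) ^ 2 * ((L - -L)⁻¹ * ‖f‖ ^ 2) = 2 * L * ‖f‖ ^ 2 := by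
    rw [sub_neg_eq_add, ← two_mul]
    field_simp
  simpa only [hcoeff, hscale] using hsum

theorem eq_zero_of_inner_eq_zero_of_tsum_norm_sub_sq_lt {ι H : Type*} [NormedAddCommGroup H]
    [InnerProductSpace ℂ H] {c : ℝ} {e v : ι → H}
    (he : ∀ f, HasSum (fun i => ‖inner ℂ (e i) f‖ ^ 2) (c * ‖f‖ ^ 2))
    (hs : Summable fun i => ‖v i - e i‖ ^ 2) (hc : ∑' i, ‖v i - e i‖ ^ 2 < c) {f : H}
    (hf : ∀ i, inner ℂ (v i) f = 0) : f = 0 := by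
  have hterm : ∀ i, ‖inner ℂ (e i) f‖ ^ 2 ≤ ‖v i - e i‖ ^ 2 * ‖f‖ ^ 2 := by
    intro i
    have : inner ℂ (e i) f = -inner ℂ (v i - e i) f := by
      rw [inner_sub_left, hf i, zero_sub, neg_neg]
    rw [this, norm_neg, ← mul_pow]
    exact pow_le_pow_left₀ (norm_nonneg _) (norm_inner_le_norm _ _) 2
  have hsum := (he f).tsum_eq ▸ (he f).summable.tsum_le_tsum hterm (hs.mul_right _)
  rw [tsum_mul_right] at hsum
  by_contra hne
  have : 0 < ‖f‖ ^ 2 := by positivity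
  nlinarith

end Parseval

section LinearSystem

theorem eqOn_Icc_of_hasDerivAt_linear {𝕜 E : Type*} [NontriviallyNormedField 𝕜]
    [NormedAddCommGroup E] [NormedSpace 𝕜 E] [NormedSpace ℝ E] {A : ℝ → E →L[𝕜] E} {a b c : ℝ}
    {f g : ℝ → E} (hA : ContinuousOn A (Icc a b))
    (hf : ∀ x ∈ Icc a b, HasDerivAt f (A x (f x)) x)
    (hg : ∀ x ∈ Icc a b, HasDerivAt g (A x (g x)) x) (hc : c ∈ Icc a b) (h : f c = g c) :
    EqOn f g (Icc a b) := by
  obtain ⟨K, hK⟩ := isCompact_Icc.exists_bound_of_continuousOn hA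
  have hlip : ∀ x ∈ Icc a b, LipschitzOnWith K.toNNReal (A x) univ := fun x hx =>
    ((A x).lipschitz.weaken
      (NNReal.coe_le_coe.1 ((hK x hx).trans (Real.le_coe_toNNReal K)))).lipschitzOnWith
  have hcont : ∀ {u : ℝ → E}, (∀ x ∈ Icc a b, HasDerivAt u (A x (u x)) x) →
      ContinuousOn u (Icc a b) := fun hu x hx => (hu x hx).continuousAt.continuousWithinAt
  have hleft : Icc a c ⊆ Icc a b := Icc_subset_Icc_right hc.2
  have hright : Icc c b ⊆ Icc a b := Icc_subset_Icc_left hc.1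
  rw [← Icc_union_Icc_eq_Icc hc.1 hc.2]
  refine EqOn.union ?_ ?_
  · exact ODE_solution_unique_of_mem_Icc_left (s := fun _ => univ)
      (fun x hx => hlip x (hleft (Ioc_subset_Icc_self hx)))
      ((hcont hf).mono hleft)
      (fun x hx => (hf x (hleft (Ioc_subset_Icc_self hx))).hasDerivWithinAt) (fun _ _ => mem_univ _)
      ((hcont hg).mono hleft)
      (fun x hx => (hg x (hleft (Ioc_subset_Icc_self hx))).hasDerivWithinAt) (fun _ _ => mem_univ _)
      h
  · exact ODE_solution_unique_of_mem_Icc_right (s := fun _ => univ)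
      (fun x hx => hlip x (hright (Ico_subset_Icc_self hx)))
      ((hcont hf).mono hright)
      (fun x hx => (hf x (hright (Ico_subset_Icc_self hx))).hasDerivWithinAt)
      (fun _ _ => mem_univ _)
      ((hcont hg).mono hright)
      (fun x hx => (hg x (hright (Ico_subset_Icc_self hx))).hasDerivWithinAt)
      (fun _ _ => mem_univ _)
      h

theorem exists_hasDerivAt_of_absolutelyContinuousOnInterval {E : Type*} [NormedAddCommGroup E]
    [NormedSpace ℝ E] [FiniteDimensional ℝ E] {a b : ℝ} (hab : a ≤ b) {w g : ℝ → E}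
    (hw : AbsolutelyContinuousOnInterval w a b) (hg : ContinuousOn g (Icc a b))
    (h : ∀ᵐ x ∂(volume.restrict (Ioo a b)), deriv w x = g x) :
    ∃ v : ℝ → E, (∀ x ∈ Icc a b, v x = w x) ∧ ∀ x ∈ Icc a b, HasDerivAt v (g x) x := by
  let G : ℝ → E := IccExtend hab ((Icc a b).domRestrict g)
  have hG : Continuous G := hg.domRestrict.Icc_extend'
  have hGg : ∀ x ∈ Icc a b, G x = g x := fun x hx => by simp [G, IccExtend_of_mem hab _ hx]
  let v : ℝ → E := fun x => w a + ∫ t in a..x, G t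
  have hv : ∀ x, HasDerivAt v (G x) x := fun x =>
    (hG.integral_hasStrictDerivAt a x).hasDerivAt.const_add _
  have hvAC : AbsolutelyContinuousOnInterval v a b := by
    refine ContDiffOn.absolutelyContinuousOnInterval (ContDiff.contDiffOn ?_)
    refine contDiff_one_iff_deriv.2 ⟨fun x => (hv x).differentiableAt, ?_⟩
    rwa [show deriv v = G from funext fun x => (hv x).deriv]
  have hzero : ∀ᵐ x, x ∈ uIcc a b → HasDerivAt (w - v) 0 x := by
    rw [ae_restrict_iff' measurableSet_Ioo] at h
    have ha : ∀ᵐ x : ℝ, x ≠ a := by simp [ae_iff]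
    have hb : ∀ᵐ x : ℝ, x ≠ b := by simp [ae_iff]
    filter_upwards [hw.boundedVariationOn.ae_differentiableAt_of_mem_uIcc, h, ha, hb]
      with x hdiff hderiv hxa hxb hx
    have hsub := (hdiff hx).hasDerivAt.sub (hv x)
    rw [uIcc_of_le hab] at hx
    rwa [hderiv ⟨lt_of_le_of_ne hx.1 hxa.symm, lt_of_le_of_ne hx.2 hxb⟩, hGg x hx, sub_self]
      at hsub
  obtain ⟨C, hC⟩ := (hw.sub hvAC).const_of_ae_hasDerivAt_zero hzero
  have hCa := hC a left_mem_uIcc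
  simp only [Pi.sub_apply, v, intervalIntegral.integral_same, add_zero, sub_self] at hCa
  refine ⟨v, fun x hx => ?_, fun x hx => hGg x hx ▸ hv x⟩
  have hCx := hC x (by rwa [uIcc_of_le hab])
  rw [← hCa, Pi.sub_apply, sub_eq_zero] at hCx
  exact hCx.symm

end LinearSystem

section EigenvalueSystem

/-- The coefficient matrix of the first order system
`w₁' = (ζ + p) w₁ - q w₂`, `w₂' = -q w₁ + (-ζ + p) w₂`, to which the eigenvalue equations of the
operator (`p = -δ`, `ζ` the eigenvalue) and of its adjoint (`p = δ`, `-ζ` the eigenvalue) reduce,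
with `q = δ / 3`. -/
def generator (p q : ℝ → ℝ) (ζ : ℂ) (x : ℝ) : C2 →L[ℂ] C2 :=
  ζ • Matrix.toEuclideanCLM (𝕜 := ℂ) Lam + (p x : ℂ) • 1 -
    (q x : ℂ) • Matrix.toEuclideanCLM (𝕜 := ℂ) !![0, 1; 1, 0]

/-- Eigenfunctions of the first order system with coefficient matrix `generator p q ζ`, with the
domain of the operator. -/
def IsSystemEigenfunction (L : ℝ) (p q : ℝ → ℝ) (ζ : ℂ) (w : ℝ → C2) : Prop :=
  MemDomain L w ∧ (∃ x ∈ Icc (0 : ℝ) L, w x ≠ 0) ∧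
    ∀ᵐ x ∂(volume.restrict (Ioo (0 : ℝ) L)), deriv w x = generator p q ζ x (w x)

variable {L γ s x : ℝ} {p q θ : ℝ → ℝ} {z ζ : ℂ} {v w : ℝ → C2}

theorem generator_apply_zero (p q : ℝ → ℝ) (ζ : ℂ) (x : ℝ) (y : C2) :
    generator p q ζ x y 0 = (ζ + p x) * y 0 - q x * y 1 := by
  simp only [generator, Lam, sub_apply, add_apply, smul_apply, one_apply_eq_self, PiLp.sub_apply,
    PiLp.add_apply, PiLp.smul_apply, Matrix.ofLp_toEuclideanCLM, Matrix.mulVec, dotProduct,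
    Matrix.of_apply, Matrix.cons_val', Matrix.cons_val_fin_one, Matrix.cons_val_zero,
    Matrix.cons_val_one, Fin.isValue, Fin.sum_univ_two, smul_eq_mul]
  ring

theorem generator_apply_one (p q : ℝ → ℝ) (ζ : ℂ) (x : ℝ) (y : C2) :
    generator p q ζ x y 1 = -q x * y 0 + (-ζ + p x) * y 1 := by
  simp only [generator, Lam, sub_apply, add_apply, smul_apply, one_apply_eq_self, PiLp.sub_apply,
    PiLp.add_apply, PiLp.smul_apply, Matrix.ofLp_toEuclideanCLM, Matrix.mulVec, dotProduct,
    Matrix.of_apply, Matrix.cons_val', Matrix.cons_val_fin_one, Matrix.cons_val_zero,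
    Matrix.cons_val_one, Fin.isValue, Fin.sum_univ_two, smul_eq_mul]
  ring

theorem continuous_generator (hp : Continuous p) (hq : Continuous q) (ζ : ℂ) :
    Continuous (generator p q ζ) := by
  unfold generator
  fun_prop

theorem S0_eq_smul_iff (hp : p x = -delta L γ x) (hq : q x = delta L γ x / 3) :
    S0 L γ w x = z • w x ↔ deriv w x = generator p q z x (w x) := by
  simp only [PiLp.ext_iff, Fin.forall_fin_two, generator_apply_zero, generator_apply_one, hp, hq]
  simp only [S0, Lam, J0, PiLp.add_apply, PiLp.smul_apply, Matrix.toLpLin_apply, Matrix.mulVec,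
    dotProduct, Fin.sum_univ_two]
  simp only [Fin.isValue, Matrix.of_apply, Matrix.cons_val_zero, Matrix.cons_val_one,
    Matrix.cons_val_fin_one, smul_eq_mul]
  push_cast
  refine and_congr ⟨fun h => ?_, fun h => ?_⟩ ⟨fun h => ?_, fun h => ?_⟩
  · linear_combination h
  · linear_combination h
  · linear_combination -h
  · linear_combination -h

theorem S0Adj_eq_smul_iff (hp : p x = delta L γ x) (hq : q x = delta L γ x / 3) :
    S0Adj L γ w x = z • w x ↔ deriv w x = generator p q (-z) x (w x) := by
  simp only [PiLp.ext_iff, Fin.forall_fin_two, generator_apply_zero, generator_apply_one, hp, hq]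
  simp only [S0Adj, Lam, J0, PiLp.add_apply, PiLp.smul_apply, PiLp.neg_apply, Matrix.toLpLin_apply,
    Matrix.mulVec, dotProduct, Fin.sum_univ_two, Matrix.conjTranspose_apply]
  simp only [Fin.isValue, Matrix.of_apply, Matrix.cons_val_zero, Matrix.cons_val_one,
    Matrix.cons_val_fin_one, smul_eq_mul, star_neg, star_one, star_div₀, star_ofNat]
  push_cast
  refine and_congr ⟨fun h => ?_, fun h => ?_⟩ ⟨fun h => ?_, fun h => ?_⟩
  · linear_combination -h
  · linear_combination -h
  · linear_combination h
  · linear_combination h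

theorem isEigenfunction_S0_iff (hp : ∀ x ∈ Icc 0 L, p x = -delta L γ x)
    (hq : ∀ x ∈ Icc 0 L, q x = delta L γ x / 3) :
    IsEigenfunction L (S0 L γ) z w ↔ IsSystemEigenfunction L p q z w := by
  refine and_congr_right fun _ => and_congr_right fun _ => eventually_congr ?_
  filter_upwards [ae_restrict_mem measurableSet_Ioo] with x hx
  exact S0_eq_smul_iff (hp x (Ioo_subset_Icc_self hx)) (hq x (Ioo_subset_Icc_self hx))

theorem isEigenfunction_S0Adj_iff (hp : ∀ x ∈ Icc 0 L, p x = delta L γ x)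
    (hq : ∀ x ∈ Icc 0 L, q x = delta L γ x / 3) :
    IsEigenfunction L (S0Adj L γ) z w ↔ IsSystemEigenfunction L p q (-z) w := by
  refine and_congr_right fun _ => and_congr_right fun _ => eventually_congr ?_
  filter_upwards [ae_restrict_mem measurableSet_Ioo] with x hx
  exact S0Adj_eq_smul_iff (hp x (Ioo_subset_Icc_self hx)) (hq x (Ioo_subset_Icc_self hx))

theorem hasDerivAt_C2 {f : ℝ → C2} {f' : C2} (h0 : HasDerivAt (fun x => f x 0) (f' 0) x)
    (h1 : HasDerivAt (fun x => f x 1) (f' 1) x) : HasDerivAt f f' x := by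
  have hpi : HasDerivAt (fun x i => f x i) (fun i => f' i) x :=
    hasDerivAt_pi.2 (Fin.forall_fin_two.2 ⟨h0, h1⟩)
  exact (PiLp.continuousLinearEquiv 2 ℝ fun _ : Fin 2 => ℂ).symm.hasFDerivAt.comp_hasDerivAt x hpi

theorem hasDerivAt_apply_C2 {f : ℝ → C2} {f' : C2} (h : HasDerivAt f f' x) (i : Fin 2) :
    HasDerivAt (fun x => f x i) (f' i) x :=
  ((EuclideanSpace.proj (𝕜 := ℂ) i).restrictScalars ℝ).hasFDerivAt.comp_hasDerivAt x h

theorem IsPruferAngle.hasDerivAt_polar (h : IsPruferAngle L q s θ) (hp : Continuous p)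
    (hq : Continuous q) (hx : x ∈ Icc 0 L) :
    HasDerivAt (polar (amplitude p q θ) θ)
      (generator p q (s * Complex.I) x (polar (amplitude p q θ) θ x)) x := by
  have hcart : ∀ y, ((amplitude p q θ y * Real.cos (θ y) : ℝ) : ℂ) +
      (amplitude p q θ y * Real.sin (θ y) : ℝ) * Complex.I =
      amplitude p q θ y * Complex.exp (θ y * Complex.I) := by
    intro y
    rw [Complex.exp_mul_I]
    push_cast
    ring
  have hconj : ∀ y, conj (amplitude p q θ y * Complex.exp (θ y * Complex.I)) =
      ((amplitude p q θ y * Real.cos (θ y) : ℝ) : ℂ) -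
        (amplitude p q θ y * Real.sin (θ y) : ℝ) * Complex.I := by
    intro y
    rw [← hcart, map_add, map_mul, Complex.conj_ofReal, Complex.conj_ofReal, Complex.conj_I]
    ring
  have hcos := (h.hasDerivAt_amplitude_mul_cos hp hq hx).ofReal_comp
  have hsin := ((h.hasDerivAt_amplitude_mul_sin hp hq hx).ofReal_comp).mul_const Complex.I
  refine hasDerivAt_C2 ?_ ?_
  · simp only [generator_apply_zero, polar_apply_zero, polar_apply_one, hconj]
    simp only [← hcart]
    convert! hcos.add hsin using 1
    push_cast
    linear_combination (s * (amplitude p q θ x * Complex.sin (θ x))) * Complex.I_sq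
  · simp only [generator_apply_one, polar_apply_zero, polar_apply_one, hconj]
    simp only [← hcart]
    convert! (hcos.sub hsin).neg using 1
    push_cast
    linear_combination (-s * (amplitude p q θ x * Complex.sin (θ x))) * Complex.I_sq

theorem isSystemEigenfunction_of_hasDerivAt (hL : 0 ≤ L) (hp : Continuous p) (hq : Continuous q)
    (hv : ∀ x ∈ Icc 0 L, HasDerivAt v (generator p q ζ x (v x)) x) (hv0 : v 0 0 = -v 0 1)
    (hvL : v L 0 = -v L 1) (hne : v 0 ≠ 0) : IsSystemEigenfunction L p q ζ v := by
  have hcont : ContinuousOn (fun x => generator p q ζ x (v x)) (Icc 0 L) :=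
    (continuous_generator hp hq ζ).continuousOn.clm_apply fun x hx =>
      (hv x hx).continuousAt.continuousWithinAt
  have hderiv : ∀ᵐ x ∂(volume.restrict (Ioo 0 L)), deriv v x = generator p q ζ x (v x) := by
    filter_upwards [ae_restrict_mem measurableSet_Ioo] with x hx
    exact (hv x (Ioo_subset_Icc_self hx)).deriv
  refine ⟨⟨⟨?_, ?_⟩, hv0, hvL⟩, ⟨0, left_mem_Icc.2 hL, hne⟩, hderiv⟩
  · obtain ⟨C, hC⟩ := isCompact_Icc.exists_bound_of_continuousOn hcont
    refine LipschitzOnWith.absolutelyContinuousOnInterval (K := C.toNNReal) ?_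
    rw [uIcc_of_le hL]
    refine (convex_Icc 0 L).lipschitzOnWith_of_nnnorm_hasDerivWithin_le
      (fun x hx => (hv x hx).hasDerivWithinAt) fun x hx => ?_
    exact NNReal.coe_le_coe.1 ((hC x hx).trans (Real.le_coe_toNNReal C))
  · exact (memLp_restrict_Ioo_of_continuousOn hcont 2).ae_eq (hderiv.mono fun x hx => hx.symm)

theorem IsPruferAngle.isSystemEigenfunction (h : IsPruferAngle L q s θ) (hL : 0 ≤ L)
    (hp : Continuous p) (hq : Continuous q) (hsin : Real.sin (θ L) = 0) {α : ℂ} (hα : α ≠ 0) :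
    IsSystemEigenfunction L p q (s * Complex.I) (fun x => α • polar (amplitude p q θ) θ x) := by
  have hr : ∀ x, amplitude p q θ x ≠ 0 := fun x => (amplitude_pos p q θ x).ne'
  have hbc : ∀ x, Real.sin (θ x) = 0 → (α • polar (amplitude p q θ) θ x) 0 =
      -(α • polar (amplitude p q θ) θ x) 1 := by
    intro x hx
    rw [PiLp.smul_apply, PiLp.smul_apply, (polar_apply_zero_eq_neg_iff (hr x)).2 hx, smul_neg]
  refine isSystemEigenfunction_of_hasDerivAt hL hp hq (fun x hx => ?_) (hbc 0 ?_) (hbc L hsin) ?_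
  · rw [map_smul]
    exact (h.hasDerivAt_polar hp hq hx).const_smul α
  · rw [h.apply_zero, Real.sin_zero]
  · exact smul_ne_zero hα fun h0 => polar_apply_zero_ne_zero (θ := θ) (hr 0) (by rw [h0]; rfl)

theorem hasDerivAt_norm_sq_sub_norm_sq (h : HasDerivAt v (generator p q ζ x (v x)) x) :
    HasDerivAt (fun x => ‖v x 0‖ ^ 2 - ‖v x 1‖ ^ 2)
      (2 * ζ.re * ‖v x‖ ^ 2 + 2 * p x * (‖v x 0‖ ^ 2 - ‖v x 1‖ ^ 2)) x := by
  convert! (hasDerivAt_apply_C2 h 0).norm_sq.sub (hasDerivAt_apply_C2 h 1).norm_sq using 1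
  rw [generator_apply_zero, generator_apply_one, EuclideanSpace.norm_sq_eq, Fin.sum_univ_two]
  simp only [Complex.inner, Complex.sq_norm, Complex.normSq_apply, Complex.mul_re, Complex.mul_im,
    Complex.add_re, Complex.add_im, Complex.sub_re, Complex.sub_im, Complex.neg_re, Complex.neg_im,
    Complex.conj_re, Complex.conj_im, Complex.ofReal_re, Complex.ofReal_im]
  ring

namespace IsSystemEigenfunction

theorem exists_hasDerivAt (h : IsSystemEigenfunction L p q ζ w) (hL : 0 ≤ L) (hp : Continuous p)
    (hq : Continuous q) : ∃ v : ℝ → C2, (∀ x ∈ Icc 0 L, v x = w x) ∧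
      ∀ x ∈ Icc 0 L, HasDerivAt v (generator p q ζ x (v x)) x := by
  obtain ⟨v, hvw, hv⟩ := exists_hasDerivAt_of_absolutelyContinuousOnInterval hL h.1.1.1
    ((continuous_generator hp hq ζ).continuousOn.clm_apply
      (uIcc_of_le hL ▸ h.1.1.1.continuousOn)) h.2.2
  refine ⟨v, hvw, fun x hx => ?_⟩
  rw [hvw x hx]
  exact hv x hx

theorem re_eq_zero (h : IsSystemEigenfunction L p q ζ w) (hL : 0 < L) (hp : Continuous p)
    (hq : Continuous q) : ζ.re = 0 := by
  obtain ⟨v, hvw, hv⟩ := h.exists_hasDerivAt hL.le hp hq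
  obtain ⟨-, hw0, hwL⟩ := h.1
  have hne : ∀ x ∈ Icc 0 L, v x ≠ 0 := by
    intro x hx hvx
    have hzero := eqOn_Icc_of_hasDerivAt_linear (continuous_generator hp hq ζ).continuousOn hv
      (g := fun _ => 0) (fun y _ => by simpa using hasDerivAt_const y (0 : C2)) hx hvx
    obtain ⟨c, hc, hwc⟩ := h.2.1
    exact hwc (by rw [← hvw c hc, hzero hc])
  have hbalance : ∀ x ∈ Icc 0 L, w x 0 = -w x 1 → ‖v x 0‖ ^ 2 - ‖v x 1‖ ^ 2 = 0 := by
    intro x hx hwx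
    rw [hvw x hx, hwx, norm_neg, sub_self]
  by_contra hre
  have hpos := pos_of_hasDerivAt_sub_mul_self (h := fun x => -(2 * p x))
    (φ := fun x => ζ.re * (‖v x 0‖ ^ 2 - ‖v x 1‖ ^ 2)) (g := fun x => 2 * ζ.re ^ 2 * ‖v x‖ ^ 2)
    hL (by fun_prop)
    (fun x hx => by have := norm_pos_iff.2 (hne x hx); positivity)
    (by simp only [hbalance 0 (left_mem_Icc.2 hL.le) hw0, mul_zero])
    (fun x hx => by
      convert! (hasDerivAt_norm_sq_sub_norm_sq (hv x hx)).const_mul ζ.re using 1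
      ring)
  rw [hbalance L (right_mem_Icc.2 hL.le) hwL, mul_zero] at hpos
  exact hpos.false

theorem exists_eq_smul_polar (h : IsSystemEigenfunction L p q (s * Complex.I) w) (hL : 0 ≤ L)
    (hp : Continuous p) (hq : Continuous q) (hθ : IsPruferAngle L q s θ) :
    ∃ α : ℂ, α ≠ 0 ∧ ∀ x ∈ Icc 0 L, w x = α • polar (amplitude p q θ) θ x := by
  obtain ⟨v, hvw, hv⟩ := h.exists_hasDerivAt hL hp hq
  have h0 : (0 : ℝ) ∈ Icc 0 L := left_mem_Icc.2 hL
  have hinit : v 0 = v 0 0 • polar (amplitude p q θ) θ 0 := by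
    have hbc : v 0 1 = -v 0 0 := by rw [hvw 0 h0, h.1.2.1, neg_neg]
    ext i
    fin_cases i <;> simp [polar, amplitude_zero, hθ.apply_zero, hbc]
  have heq := eqOn_Icc_of_hasDerivAt_linear (continuous_generator hp hq _).continuousOn hv
    (g := fun x => v 0 0 • polar (amplitude p q θ) θ x)
    (fun x hx => by
      rw [map_smul]
      exact (hθ.hasDerivAt_polar hp hq hx).const_smul (v 0 0)) h0 hinit
  have hw : ∀ x ∈ Icc 0 L, w x = v 0 0 • polar (amplitude p q θ) θ x :=
    fun x hx => by rw [← hvw x hx, heq hx]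
  refine ⟨v 0 0, fun hα => ?_, hw⟩
  obtain ⟨c, hc, hwc⟩ := h.2.1
  exact hwc (by rw [hw c hc, hα, zero_smul])

theorem exists_int_apply_eq (h : IsSystemEigenfunction L p q (s * Complex.I) w) (hL : 0 ≤ L)
    (hp : Continuous p) (hq : Continuous q) (hθ : IsPruferAngle L q s θ) :
    ∃ n : ℤ, θ L = Real.pi * n := by
  obtain ⟨α, hα, hw⟩ := h.exists_eq_smul_polar hL hp hq hθ
  have hbc := h.1.2.2
  rw [hw L (right_mem_Icc.2 hL), PiLp.smul_apply, PiLp.smul_apply, smul_eq_mul, smul_eq_mul,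
    ← mul_neg] at hbc
  obtain ⟨n, hn⟩ := Real.sin_eq_zero_iff.1
    ((polar_apply_zero_eq_neg_iff (amplitude_pos p q θ L).ne').1 (mul_left_cancel₀ hα hbc))
  exact ⟨n, by rw [← hn, mul_comm]⟩

end IsSystemEigenfunction

end EigenvalueSystem

section RieszBasis

variable {ι H : Type*} [NormedAddCommGroup H] {v : ι → H}

theorem exists_continuousLinearEquiv_apply_eq_smul {𝕜 : Type*} [RCLike 𝕜] [InnerProductSpace 𝕜 H]
    (b : HilbertBasis ι 𝕜 H) {c : ι → 𝕜} {C m : ℝ} (hm : 0 < m) (hcm : ∀ i, m ≤ ‖c i‖)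
    (hC : ∀ i, ‖c i‖ ≤ C) : ∃ D : H ≃L[𝕜] H, ∀ i, D (b i) = c i • b i := by
  classical
  have hc : ∀ i, c i ≠ 0 := fun i => norm_pos_iff.1 (hm.trans_le (hcm i))
  have hinv : ∀ i, ‖(c i)⁻¹‖ ≤ m⁻¹ := fun i => norm_inv (c i) ▸ inv_anti₀ hm (hcm i)
  let diag (a : ι → 𝕜) {K : ℝ} (ha : ∀ i, ‖a i‖ ≤ K) :
      lp (fun _ : ι => 𝕜) 2 →L[𝕜] lp (fun _ : ι => 𝕜) 2 :=
    lp.mapCLM 2 (fun i => a i • ContinuousLinearMap.id 𝕜 𝕜) (abs_nonneg K) fun i => by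
      rw [norm_smul, ContinuousLinearMap.norm_id, mul_one]
      exact (ha i).trans (le_abs_self K)
  let E : lp (fun _ : ι => 𝕜) 2 ≃L[𝕜] lp (fun _ : ι => 𝕜) 2 :=
    ContinuousLinearEquiv.equivOfInverse (diag c hC) (diag (fun i => (c i)⁻¹) hinv)
      (fun f => lp.ext (funext fun i => inv_mul_cancel_left₀ (hc i) _))
      (fun f => lp.ext (funext fun i => mul_inv_cancel_left₀ (hc i) _))
  let e := b.repr.toContinuousLinearEquiv
  refine ⟨(e.trans E).trans e.symm, fun i => ?_⟩
  have hE : E (b.repr (b i)) = c i • b.repr (b i) := by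
    ext j
    change c j * b.repr (b i) j = c i * b.repr (b i) j
    obtain rfl | hj := eq_or_ne j i
    · rfl
    · rw [b.repr_self, lp.single_apply_ne _ _ _ hj, mul_zero, mul_zero]
  change b.repr.symm (E (b.repr (b i))) = _
  rw [hE, map_smul, LinearIsometryEquiv.symm_apply_apply]

theorem exists_hilbertBasis_of_orthogonal {𝕜 : Type*} [RCLike 𝕜] [InnerProductSpace 𝕜 H]
    [CompleteSpace H] (hv : Pairwise fun i j => inner 𝕜 (v i) (v j) = 0)
    (hcomplete : ∀ f, (∀ i, inner 𝕜 (v i) f = 0) → f = 0) (hv0 : ∀ i, v i ≠ 0) :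
    ∃ b : HilbertBasis ι 𝕜 H, ∀ i, v i = (‖v i‖ : 𝕜) • b i := by
  have hnorm : ∀ i, (‖v i‖ : 𝕜) ≠ 0 := fun i => RCLike.ofReal_ne_zero.2 (norm_ne_zero_iff.2 (hv0 i))
  have hu : Orthonormal 𝕜 fun i => (‖v i‖ : 𝕜)⁻¹ • v i :=
    ⟨fun i => norm_smul_inv_norm (hv0 i), fun i j hij => by
      simp only [inner_smul_left, inner_smul_right, hv hij, mul_zero]⟩
  have hbot : (Submodule.span 𝕜 (range fun i => (‖v i‖ : 𝕜)⁻¹ • v i))ᗮ = ⊥ := by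
    refine (Submodule.eq_bot_iff _).2 fun f hf => hcomplete f fun i => ?_
    have hfi := (Submodule.mem_orthogonal _ f).1 hf _ (Submodule.subset_span ⟨i, rfl⟩)
    rw [inner_smul_left, map_inv₀, RCLike.conj_ofReal] at hfi
    exact (mul_eq_zero.1 hfi).resolve_left (inv_ne_zero (hnorm i))
  refine ⟨HilbertBasis.mkOfOrthogonalEqBot hu hbot, fun i => ?_⟩
  rw [HilbertBasis.coe_mkOfOrthogonalEqBot, smul_inv_smul₀ (hnorm i)]

theorem isRieszBasis_of_orthogonal [InnerProductSpace ℂ H] [CompleteSpace H]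
    (hv : Pairwise fun i j => inner ℂ (v i) (v j) = 0)
    (hcomplete : ∀ f, (∀ i, inner ℂ (v i) f = 0) → f = 0) {a : ι → ℂ} {m M : ℝ} (hm : 0 < m)
    (hlow : ∀ i, m ≤ ‖a i • v i‖) (hup : ∀ i, ‖a i • v i‖ ≤ M) (A : H ≃L[ℂ] H) :
    IsRieszBasis fun i => A (a i • v i) := by
  have hv0 : ∀ i, v i ≠ 0 := fun i h => by
    have := hlow i
    rw [h, smul_zero, norm_zero] at this
    exact hm.not_ge this
  obtain ⟨b, hb⟩ := exists_hilbertBasis_of_orthogonal hv hcomplete hv0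
  have hnorm : ∀ i, ‖a i * (‖v i‖ : ℂ)‖ = ‖a i • v i‖ := fun i => by
    rw [norm_mul, norm_smul, Complex.norm_real, norm_norm]
  obtain ⟨D, hD⟩ := exists_continuousLinearEquiv_apply_eq_smul b hm
    (fun i => (hlow i).trans_eq (hnorm i).symm) (fun i => (hnorm i).trans_le (hup i))
  refine ⟨b, D.trans A, fun i => ?_⟩
  rw [ContinuousLinearEquiv.trans_apply, hD, mul_smul]
  exact congrArg (fun y => A (a i • y)) (hb i)

theorem exists_continuousLinearEquiv_coeFn_eq_smul {α 𝕜 E : Type*} [MeasurableSpace α]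
    {μ : Measure α} [NontriviallyNormedField 𝕜] [NormedAddCommGroup E] [NormedSpace 𝕜 E] {p : ℝ≥0∞}
    [Fact (1 ≤ p)] {m : α → 𝕜} (hm : MemLp m ∞ μ) (hm' : MemLp (fun x => (m x)⁻¹) ∞ μ)
    (hm0 : ∀ᵐ x ∂μ, m x ≠ 0) :
    ∃ A : Lp E p μ ≃L[𝕜] Lp E p μ, ∀ f, A f =ᵐ[μ] fun x => m x • f x := by
  let mul : Lp 𝕜 ∞ μ → Lp E p μ →L[𝕜] Lp E p μ :=
    (ContinuousLinearMap.lsmul 𝕜 𝕜).holderL μ ∞ p p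
  have hmul : ∀ {g : α → 𝕜} (hg : MemLp g ∞ μ) (f : Lp E p μ),
      mul (hg.toLp g) f =ᵐ[μ] fun x => g x • f x := by
    intro g hg f
    filter_upwards [ContinuousLinearMap.coeFn_holder (r := p) (ContinuousLinearMap.lsmul 𝕜 𝕜)
      (hg.toLp g) f, hg.coeFn_toLp] with x hx hgx
    exact hx.trans (by rw [hgx, ContinuousLinearMap.lsmul_apply])
  refine ⟨ContinuousLinearEquiv.equivOfInverse (mul (hm.toLp m)) (mul (hm'.toLp _))
    (fun f => Lp.ext ?_) (fun f => Lp.ext ?_), hmul hm⟩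
  · filter_upwards [hmul hm f, hmul hm' (mul (hm.toLp m) f), hm0] with x hx hx' hx0
    rw [hx', hx, inv_smul_smul₀ hx0]
  · filter_upwards [hmul hm' f, hmul hm (mul (hm'.toLp _) f), hm0] with x hx hx' hx0
    rw [hx', hx, smul_inv_smul₀ hx0]

theorem exists_continuousLinearEquiv_toLp_eq_toLp_smul {E : Type*} [NormedAddCommGroup E]
    [NormedSpace ℂ E] {p : ℝ≥0∞} [Fact (1 ≤ p)] {m : ℝ → ℂ} (hm : Continuous m)
    (hm0 : ∀ x, m x ≠ 0) (a b : ℝ) :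
    ∃ A : Lp E p (volume.restrict (Ioo a b)) ≃L[ℂ] Lp E p (volume.restrict (Ioo a b)),
      ∀ (f : ℝ → E) (hf : MemLp f p (volume.restrict (Ioo a b)))
        (hmf : MemLp (fun x => m x • f x) p (volume.restrict (Ioo a b))),
        A (hf.toLp f) = hmf.toLp _ := by
  obtain ⟨A, hA⟩ := exists_continuousLinearEquiv_coeFn_eq_smul (E := E) (p := p)
    (memLp_restrict_Ioo_of_continuousOn hm.continuousOn (a := a) (b := b) ∞)
    (memLp_restrict_Ioo_of_continuousOn (hm.inv₀ hm0).continuousOn ∞) (ae_of_all _ hm0)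
  refine ⟨A, fun f hf hmf => Lp.ext ?_⟩
  filter_upwards [hA (hf.toLp f), hf.coeFn_toLp, hmf.coeFn_toLp] with x hAx hfx hmfx
  rw [hAx, hfx, hmfx]

end RieszBasis

section Delta

variable {L γ x : ℝ}

theorem delta_eq (hγ : γ ≠ 0) (hL : L ≠ 0) (x : ℝ) :
    delta L γ x = -(3 / 2) * ((√(1 + γ * L / 2) - √(1 - γ * L / 2)) / L /
      (√(1 + γ * L / 2) - (√(1 + γ * L / 2) - √(1 - γ * L / 2)) / L * x)) := by
  have hslope : γ * Lgam L γ * x / (2 * L) =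
      (√(1 + γ * L / 2) - √(1 - γ * L / 2)) / L * x := by
    rw [Lgam]
    field_simp
  rw [delta, hslope, Lgam, ← mul_div_assoc, ← mul_div_assoc]
  congr 1
  field_simp
  ring

theorem sqrt_add_mem (hL : 0 ≤ L) (hγ : 0 ≤ γ) (h : γ * L ≤ 1 / 4) :
    √(1 + γ * L / 2) ∈ Icc (9 / 10) (11 / 10) := by
  have := mul_nonneg hγ hL
  exact ⟨Real.le_sqrt_of_sq_le (by linarith), (Real.sqrt_le_left (by norm_num)).2 (by linarith)⟩

theorem sqrt_sub_mem (hL : 0 ≤ L) (hγ : 0 ≤ γ) (h : γ * L ≤ 1 / 4) :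
    √(1 - γ * L / 2) ∈ Icc (9 / 10) (11 / 10) := by
  have := mul_nonneg hγ hL
  exact ⟨Real.le_sqrt_of_sq_le (by linarith), (Real.sqrt_le_left (by norm_num)).2 (by linarith)⟩

theorem sub_div_mul_mem_Icc {a b c d : ℝ} (hL : 0 < L) (ha : a ∈ Icc c d) (hb : b ∈ Icc c d)
    (hx : x ∈ Icc 0 L) : a - (a - b) / L * x ∈ Icc c d := by
  have hconv : (1 - x / L) • a + (x / L) • b ∈ Icc c d :=
    convex_Icc c d ha hb (sub_nonneg.2 (div_le_one_of_le₀ hx.2 hL.le)) (div_nonneg hx.1 hL.le)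
      (sub_add_cancel _ _)
  convert hconv using 1
  rw [smul_eq_mul, smul_eq_mul]
  ring

theorem delta_denominator_mem (hL : 0 < L) (hγ : 0 ≤ γ) (h : γ * L ≤ 1 / 4) (hx : x ∈ Icc 0 L) :
    √(1 + γ * L / 2) - (√(1 + γ * L / 2) - √(1 - γ * L / 2)) / L * x ∈ Icc (9 / 10) (11 / 10) :=
  sub_div_mul_mem_Icc hL (sqrt_add_mem hL.le hγ h) (sqrt_sub_mem hL.le hγ h) hx

theorem delta_mem_Icc (hL : 0 < L) (hγ : 0 < γ) (h : γ * L ≤ 1 / 4) (hx : x ∈ Icc 0 L) :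
    delta L γ x ∈ Icc (-(3 / 2 * γ)) (-(γ / 2)) := by
  have hadd := sqrt_add_mem hL.le hγ.le h
  have hsub := sqrt_sub_mem hL.le hγ.le h
  have hden := delta_denominator_mem hL hγ.le h hx
  have hprod : (√(1 + γ * L / 2) - √(1 - γ * L / 2)) * (√(1 + γ * L / 2) + √(1 - γ * L / 2)) =
      γ * L := by
    have := mul_pos hγ hL
    linear_combination Real.mul_self_sqrt (show 0 ≤ 1 + γ * L / 2 by linarith) -
      Real.mul_self_sqrt (show 0 ≤ 1 - γ * L / 2 by linarith)
  rw [delta_eq hγ.ne' hL.ne']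
  generalize √(1 + γ * L / 2) - (√(1 + γ * L / 2) - √(1 - γ * L / 2)) / L * x = D at *
  generalize √(1 + γ * L / 2) = A at *
  generalize √(1 - γ * L / 2) = B at *
  have hslope : (A - B) / L = γ / (A + B) := by
    rw [div_eq_div_iff hL.ne' (by linarith [hadd.1, hsub.1]), hprod]
  have hone : 1 ≤ (A + B) * D := by nlinarith [hadd.1, hsub.1, hden.1]
  have hthree : (A + B) * D ≤ 3 := by nlinarith [hadd.2, hsub.2, hden.1, hden.2]
  have hle : γ / ((A + B) * D) ≤ γ := div_le_self hγ.le hone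
  have hge : γ / 3 ≤ γ / ((A + B) * D) := by gcongr
  rw [hslope, div_div]
  constructor <;> linarith

theorem hasDerivAt_delta (hL : 0 < L) (hγ : 0 < γ) (h : γ * L ≤ 1 / 4) (hx : x ∈ Icc 0 L) :
    HasDerivAt (delta L γ) (-(2 / 3) * delta L γ x ^ 2) x := by
  have hden := (delta_denominator_mem hL hγ.le h hx).1
  rw [delta_eq hγ.ne' hL.ne', show delta L γ = _ from funext (delta_eq hγ.ne' hL.ne')]
  generalize (√(1 + γ * L / 2) - √(1 - γ * L / 2)) / L = B at *
  generalize √(1 + γ * L / 2) = A at *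
  have hne : A - B * x ≠ 0 := by linarith
  have hlin : HasDerivAt (fun y => A - B * y) (-B) x := by
    simpa using ((hasDerivAt_id x).const_mul B).const_sub A
  convert! ((hasDerivAt_const x B).div hlin hne).const_mul (-(3 / 2)) using 1
  field_simp
  ring

theorem continuousOn_uncurry_delta {γ₀ : ℝ} (hL : 0 < L) (hγ₀ : γ₀ * L ≤ 1 / 4) :
    ContinuousOn (Function.uncurry (delta L)) (Ioo 0 γ₀ ×ˢ Icc 0 L) := by
  have hcont : ContinuousOn (fun p : ℝ × ℝ => -(3 / 2) *
      ((√(1 + p.1 * L / 2) - √(1 - p.1 * L / 2)) / L /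
        (√(1 + p.1 * L / 2) - (√(1 + p.1 * L / 2) - √(1 - p.1 * L / 2)) / L * p.2)))
      (Ioo 0 γ₀ ×ˢ Icc 0 L) := by
    refine continuousOn_const.mul (ContinuousOn.div ?_ ?_ fun p hp => ?_)
    · exact Continuous.continuousOn (by fun_prop)
    · exact Continuous.continuousOn (by fun_prop)
    · have hle : p.1 * L ≤ 1 / 4 := (mul_le_mul_of_nonneg_right hp.1.2.le hL.le).trans hγ₀
      linarith [(delta_denominator_mem hL hp.1.1.le hle hp.2).1]
  exact hcont.congr fun p hp => delta_eq hp.1.1.ne' hL.ne' p.2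

/-- The coefficient `δ`, extended from `[0, L]` to the line by constants. -/
def deltaExt (L γ x : ℝ) : ℝ := delta L γ (max 0 (min x L))

theorem deltaExt_of_mem (hx : x ∈ Icc 0 L) : deltaExt L γ x = delta L γ x := by
  rw [deltaExt, min_eq_left hx.2, max_eq_right hx.1]

theorem max_min_mem_Icc (hL : 0 ≤ L) (x : ℝ) : max 0 (min x L) ∈ Icc 0 L :=
  ⟨le_max_left _ _, max_le hL (min_le_right _ _)⟩

theorem deltaExt_mem_Icc (hL : 0 < L) (hγ : 0 < γ) (h : γ * L ≤ 1 / 4) (x : ℝ) :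
    deltaExt L γ x ∈ Icc (-(3 / 2 * γ)) (-(γ / 2)) :=
  delta_mem_Icc hL hγ h (max_min_mem_Icc hL.le x)

theorem continuous_deltaExt (hL : 0 < L) (hγ : 0 < γ) (h : γ * L ≤ 1 / 4) :
    Continuous (deltaExt L γ) := by
  have hcont : ContinuousOn (delta L γ) (Icc 0 L) := fun x hx =>
    (hasDerivAt_delta hL hγ h hx).continuousAt.continuousWithinAt
  exact hcont.comp_continuous (by fun_prop) (max_min_mem_Icc hL.le)

theorem hasDerivAt_deltaExt (hL : 0 < L) (hγ : 0 < γ) (h : γ * L ≤ 1 / 4) (hx : x ∈ Ioo 0 L) :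
    HasDerivAt (deltaExt L γ) (-(2 / 3) * deltaExt L γ x ^ 2) x := by
  rw [deltaExt_of_mem (Ioo_subset_Icc_self hx)]
  refine (hasDerivAt_delta hL hγ h (Ioo_subset_Icc_self hx)).congr_of_eventuallyEq ?_
  filter_upwards [Ioo_mem_nhds hx.1 hx.2] with y hy
  exact deltaExt_of_mem (Ioo_subset_Icc_self hy)

/-- The off-diagonal coefficient `δ / 3` of `δ J₀`, extended like `δ`. -/
def coupling (L γ x : ℝ) : ℝ := deltaExt L γ x / 3

theorem coupling_of_mem (hx : x ∈ Icc 0 L) : coupling L γ x = delta L γ x / 3 := by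
  rw [coupling, deltaExt_of_mem hx]

theorem isCoupling_coupling (hL : 0 < L) (hγ : 0 < γ) (h : γ * L ≤ 1 / 4) :
    IsCoupling L (γ / 2) (coupling L γ) where
  continuous := (continuous_deltaExt hL hγ h).div_const 3
  abs_le x := by
    obtain ⟨hlow, hup⟩ := deltaExt_mem_Icc hL hγ h x
    rw [coupling, abs_le]
    constructor <;> linarith
  exists_hasDerivWithinAt x hx := by
    obtain ⟨hlow, hup⟩ := delta_mem_Icc hL hγ h hx
    refine ⟨_, ((hasDerivAt_delta hL hγ h hx).hasDerivWithinAt.div_const 3).congr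
      (fun y hy => coupling_of_mem hy) (coupling_of_mem hx), ?_⟩
    rw [abs_le]
    constructor <;> nlinarith

theorem eventually_abs_deltaExt_sub_lt {γ₀ η : ℝ} (hL : 0 < L) (hγ₀ : γ₀ * L ≤ 1 / 4)
    (hη : 0 < η) (hγ : γ ∈ Ioo 0 γ₀) :
    ∀ᶠ γ' in 𝓝[Ioo 0 γ₀] γ, ∀ x ∈ Icc 0 L, |deltaExt L γ' x - deltaExt L γ x| < η := by
  obtain ⟨v, hv, hv'⟩ := isCompact_Icc.mem_uniformity_of_prod (continuousOn_uncurry_delta hL hγ₀)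
    hγ (Metric.dist_mem_uniformity hη)
  filter_upwards [hv] with γ' hγ' x hx
  rw [deltaExt_of_mem hx, deltaExt_of_mem hx]
  exact hv' γ' hγ' x hx

end Delta

section Mode

/-- The mean over `[0, L]` of `r cos (θ - φ)`, where `φ` is the phase of `psi0 L n`: it is the
pairing of `polar r θ` with `psi0 L n`. -/
def overlap (L : ℝ) (n : ℤ) (r θ : ℝ → ℝ) : ℝ :=
  1 / L * ∫ x in (0 : ℝ)..L, r x * Real.cos (θ x - phase L n x)

/-- The multiple of `polar (amplitude p q θ) θ` whose pairing with `psi0 L n` is `1`. -/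
def mode (L : ℝ) (n : ℤ) (p q θ : ℝ → ℝ) (x : ℝ) : C2 :=
  (((overlap L n (amplitude p q θ) θ)⁻¹ : ℝ) : ℂ) • polar (amplitude p q θ) θ x

variable {L k s : ℝ} {p q θ : ℝ → ℝ} {n : ℤ} {w : ℝ → C2}

theorem abs_mean_sub_one_le {c : ℝ} (hL : 0 < L) {f : ℝ → ℝ} (hf : Continuous f)
    (h : ∀ x ∈ Icc 0 L, |f x - 1| ≤ c) : |1 / L * (∫ x in (0 : ℝ)..L, f x) - 1| ≤ c := by
  have hint : ∫ x in (0 : ℝ)..L, (f x - 1) = (∫ x in (0 : ℝ)..L, f x) - L := by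
    rw [intervalIntegral.integral_sub (hf.intervalIntegrable _ _) (by simp)]
    simp
  have hle := intervalIntegral.norm_integral_le_of_norm_le_const (a := 0) (b := L)
    (f := fun x => f x - 1) (C := c) fun x hx =>
      h x (Ioc_subset_Icc_self (uIoc_of_le hL.le ▸ hx))
  rw [hint, sub_zero, Real.norm_eq_abs, abs_of_pos hL] at hle
  have hmean : 1 / L * (∫ x in (0 : ℝ)..L, f x) - 1 = ((∫ x in (0 : ℝ)..L, f x) - L) / L := by
    field_simp
  rwa [hmean, abs_div, abs_of_pos hL, div_le_iff₀ hL]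

theorem inv_mem_Icc_of_abs_sub_one_le {x : ℝ} (hx : |x - 1| ≤ 1 / 100) :
    x⁻¹ ∈ Icc (95 / 100 : ℝ) (105 / 100) := by
  rw [abs_le] at hx
  have h0 : 0 < x := by linarith
  constructor
  · rw [le_inv_comm₀ (by norm_num) h0]
    linarith
  · rw [inv_le_comm₀ h0 (by norm_num)]
    linarith

theorem sin_eq_zero_of_eq_pi_mul_int {x : ℝ} (hx : x = Real.pi * n) : Real.sin x = 0 := by
  rw [hx, mul_comm, Real.sin_int_mul_pi]

namespace IsPruferAngle

theorem abs_overlap_amplitude_sub_one_le (h : IsPruferAngle L q s θ) (hL : 0 < L)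
    (hp : Continuous p) (hpk : ∀ x, |p x| ≤ 3 * k) (hq : IsCoupling L k q)
    (hkL : k * L ≤ 1 / 1000) (hn : θ L = Real.pi * n) :
    |overlap L n (amplitude p q θ) θ - 1| ≤ 1 / 100 := by
  have hθ := h.continuous
  have hr := continuous_amplitude hp hq.continuous hθ
  have hφ := continuous_phase L n
  have hkL0 := mul_nonneg hq.nonneg hL.le
  refine abs_mean_sub_one_le hL (by fun_prop) fun x hx => ?_
  have hamp := abs_amplitude_sub_one_le (θ := θ) hpk hq.abs_le hx (by linarith)
  have hangle : |θ x - phase L n x| ≤ 1 / 500 := by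
    have hle : k * L / √(1 + (n : ℝ) ^ 2) ≤ k * L :=
      div_le_self hkL0 (Real.one_le_sqrt.2 (by nlinarith))
    linarith [h.abs_sub_phase_le hL hq hkL hn hx]
  have hcos : |Real.cos (θ x - phase L n x) - 1| ≤ 1 / 100000 := by
    have hsq := pow_le_pow_left₀ (abs_nonneg _) hangle 2
    rw [sq_abs] at hsq
    rw [abs_le]
    constructor <;> linarith [Real.one_sub_sq_div_two_le_cos (x := θ x - phase L n x),
      Real.cos_le_one (θ x - phase L n x)]
  generalize Real.cos (θ x - phase L n x) = c at *
  generalize amplitude p q θ x = r at *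
  rw [abs_le] at hamp hcos ⊢
  constructor <;> nlinarith

theorem inv_overlap_amplitude_mem_Icc (h : IsPruferAngle L q s θ) (hL : 0 < L)
    (hp : Continuous p) (hpk : ∀ x, |p x| ≤ 3 * k) (hq : IsCoupling L k q)
    (hkL : k * L ≤ 1 / 1000) (hn : θ L = Real.pi * n) :
    (overlap L n (amplitude p q θ) θ)⁻¹ ∈ Icc (95 / 100 : ℝ) (105 / 100) :=
  inv_mem_Icc_of_abs_sub_one_le (h.abs_overlap_amplitude_sub_one_le hL hp hpk hq hkL hn)

theorem overlap_amplitude_ne_zero (h : IsPruferAngle L q s θ) (hL : 0 < L)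
    (hp : Continuous p) (hpk : ∀ x, |p x| ≤ 3 * k) (hq : IsCoupling L k q)
    (hkL : k * L ≤ 1 / 1000) (hn : θ L = Real.pi * n) :
    overlap L n (amplitude p q θ) θ ≠ 0 := fun h0 => by
  have := (h.inv_overlap_amplitude_mem_Icc hL hp hpk hq hkL hn).1
  rw [h0, inv_zero] at this
  norm_num at this

end IsPruferAngle

theorem pairing_smul_polar_psi0 (L : ℝ) (α : ℂ) (r θ : ℝ → ℝ) (n : ℤ) :
    pairing L (fun x => α • polar r θ x) (psi0 L n) = α * overlap L n r θ := by
  have := pairing_smul_polar L α 1 r θ 1 (phase L n)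
  simp only [map_one, mul_one, one_smul, Pi.one_apply] at this
  rw [psi0_eq_polar, overlap]
  exact this

theorem pairing_mode_psi0 (h : overlap L n (amplitude p q θ) θ ≠ 0) :
    pairing L (mode L n p q θ) (psi0 L n) = 1 := by
  unfold mode
  rw [pairing_smul_polar_psi0, ← Complex.ofReal_mul, inv_mul_cancel₀ h, Complex.ofReal_one]

theorem IsPruferAngle.isSystemEigenfunction_mode (h : IsPruferAngle L q s θ) (hL : 0 ≤ L)
    (hp : Continuous p) (hq : Continuous q) (hn : θ L = Real.pi * n)
    (h0 : overlap L n (amplitude p q θ) θ ≠ 0) :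
    IsSystemEigenfunction L p q (s * Complex.I) (mode L n p q θ) :=
  h.isSystemEigenfunction hL hp hq (sin_eq_zero_of_eq_pi_mul_int hn)
    (Complex.ofReal_ne_zero.2 (inv_ne_zero h0))

theorem IsSystemEigenfunction.eq_mode (hw : IsSystemEigenfunction L p q (s * Complex.I) w)
    (hL : 0 ≤ L) (hp : Continuous p) (hq : Continuous q) (h : IsPruferAngle L q s θ)
    (hpair : pairing L w (psi0 L n) = 1) : ∀ x ∈ Icc 0 L, w x = mode L n p q θ x := by
  obtain ⟨α, -, hα⟩ := hw.exists_eq_smul_polar hL hp hq h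
  rw [pairing_congr hL hα fun _ _ => rfl, pairing_smul_polar_psi0] at hpair
  unfold mode
  rwa [Complex.ofReal_inv, ← eq_inv_of_mul_eq_one_left hpair]

theorem pairing_mode_neg_mode (hp : Continuous p) (hq : Continuous q) (hθ : Continuous θ) :
    pairing L (mode L n (-p) q θ) (mode L n p q θ) =
      ((overlap L n (amplitude (-p) q θ) θ)⁻¹ * (overlap L n (amplitude p q θ) θ)⁻¹ *
        (1 / L * ∫ x in (0 : ℝ)..L, amplitude 0 q θ x ^ 2) : ℝ) := by
  unfold mode
  rw [pairing_smul_polar]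
  simp only [sub_self, Real.cos_zero, mul_one, amplitude_neg_mul_amplitude hp hq hθ,
    Complex.conj_ofReal]
  push_cast
  ring

theorem abs_mean_amplitude_zero_left_sq_sub_one_le (hL : 0 < L) (hq : IsCoupling L k q)
    (hkL : k * L ≤ 1 / 1000) (hθ : Continuous θ) :
    |1 / L * (∫ x in (0 : ℝ)..L, amplitude 0 q θ x ^ 2) - 1| ≤ 1 / 100 := by
  refine abs_mean_sub_one_le hL
    ((continuous_amplitude continuous_zero hq.continuous hθ).pow 2) fun x hx => ?_
  have := abs_amplitude_sub_one_le (p := 0) (c := 0) (θ := θ) (by simp) hq.abs_le hx (by linarith)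
  rw [abs_le] at this ⊢
  constructor <;> nlinarith

theorem IsPruferAngle.norm_pairing_mode_neg_mode_mem_Ioo (h : IsPruferAngle L q s θ) (hL : 0 < L)
    (hp : Continuous p) (hpk : ∀ x, |p x| ≤ 3 * k) (hq : IsCoupling L k q)
    (hkL : k * L ≤ 1 / 1000) (hn : θ L = Real.pi * n) :
    ‖pairing L (mode L n (-p) q θ) (mode L n p q θ)‖ ∈ Ioo (1 / 2 : ℝ) 2 := by
  obtain ⟨hψ, hψ'⟩ := h.inv_overlap_amplitude_mem_Icc hL hp.neg
    (fun x => (abs_neg (p x)).trans_le (hpk x)) hq hkL hn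
  obtain ⟨hχ, hχ'⟩ := h.inv_overlap_amplitude_mem_Icc hL hp hpk hq hkL hn
  obtain ⟨hr, hr'⟩ := abs_le.1 (abs_mean_amplitude_zero_left_sq_sub_one_le hL hq hkL h.continuous)
  rw [pairing_mode_neg_mode hp hq.continuous h.continuous, Complex.norm_real]
  generalize (overlap L n (amplitude (-p) q θ) θ)⁻¹ = b at *
  generalize (overlap L n (amplitude p q θ) θ)⁻¹ = c at *
  generalize 1 / L * ∫ x in (0 : ℝ)..L, amplitude 0 q θ x ^ 2 = m at *
  have hbc : 9 / 10 ≤ b * c ∧ b * c ≤ 12 / 10 := by constructor <;> nlinarith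
  rw [Real.norm_of_nonneg (mul_nonneg (by linarith) (by linarith))]
  constructor <;> nlinarith

end Mode

section Moment

variable {L a k s : ℝ} {p q θ : ℝ → ℝ} {n : ℤ}

theorem IsPruferAngle.eq_zero_of_apply_eq_zero (h : IsPruferAngle L q s θ) (hL : 0 < L)
    (hq : Continuous q) {k : ℝ≥0} (hk : ∀ x, |q x| ≤ k) (h0 : θ L = 0) {x : ℝ}
    (hx : x ∈ Icc 0 L) : θ x = 0 := by
  have hzero : ∀ y, IsPruferAngle y q 0 0 := fun y => ⟨continuous_const, rfl, fun x _ => by simp⟩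
  have hs : s = 0 := by
    have := h.abs_spectral_sub_le (η := 0) hL hq hq (hzero L) (by simp) h0
    rwa [sub_zero, abs_nonpos_iff] at this
  have hsub : IsPruferAngle x q s θ :=
    ⟨h.continuous, h.apply_zero, fun y hy => h.hasDerivAt y ⟨hy.1, hy.2.trans hx.2⟩⟩
  have := hsub.dist_apply_le_gronwallBound hx.1 hk (hzero x)
  rwa [hs, dist_self, gronwallBound_ε0_δ0, Pi.zero_apply, dist_le_zero] at this

theorem pairing_mode_controlProfile (L : ℝ) (n : ℤ) (p q θ : ℝ → ℝ) :
    pairing L (mode L n p q θ) controlProfile =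
      ((overlap L n (amplitude p q θ) θ)⁻¹ *
        (1 / L * ∫ x in (0 : ℝ)..L, amplitude p q θ x * Real.sin (θ x)) : ℝ) * Complex.I := by
  unfold mode
  rw [pairing_smul_polar_controlProfile]
  push_cast
  ring

theorem IsPruferAngle.pairing_mode_controlProfile_eq_zero (h : IsPruferAngle L q s θ) (hL : 0 < L)
    (hq : IsCoupling L k q) (h0 : θ L = 0) : pairing L (mode L n p q θ) controlProfile = 0 := by
  have hθ : ∀ x ∈ Icc 0 L, θ x = 0 := fun x hx =>
    h.eq_zero_of_apply_eq_zero hL hq.continuous (k := ⟨k, hq.nonneg⟩) hq.abs_le h0 hx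
  have hint : ∫ x in (0 : ℝ)..L, amplitude p q θ x * Real.sin (θ x) = 0 := by
    refine (intervalIntegral.integral_congr fun x hx => ?_).trans intervalIntegral.integral_zero
    simp only [hθ x (uIcc_of_le hL.le ▸ hx), Real.sin_zero, mul_zero]
  rw [pairing_mode_controlProfile, hint]
  simp

theorem amplitude_le_one_sub (hL : 0 ≤ L) (hp : Continuous p) (hq : Continuous q)
    (hθ : Continuous θ) (ha : 0 ≤ a) (haL : a * L ≤ 1) (hpq : ∀ x, p x + |q x| ≤ -a) :
    amplitude p q θ L ≤ 1 - a * L / 2 := by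
  have haL0 := mul_nonneg ha hL
  have hint : ∫ t in (0 : ℝ)..L, (p t + q t * Real.cos (2 * θ t)) ≤ ∫ _ in (0 : ℝ)..L, -a := by
    have hcont : Continuous fun t => p t + q t * Real.cos (2 * θ t) := by fun_prop
    refine intervalIntegral.integral_mono_on hL (hcont.intervalIntegrable _ _) (by simp)
      fun t _ => ?_
    have hcos : q t * Real.cos (2 * θ t) ≤ |q t| := (le_abs_self _).trans
      ((abs_mul _ _).trans_le (mul_le_of_le_one_right (abs_nonneg _) (Real.abs_cos_le_one _)))
    linarith [hpq t]
  rw [intervalIntegral.integral_const, sub_zero, smul_eq_mul, mul_neg, mul_comm L] at hint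
  calc amplitude p q θ L ≤ Real.exp (-(a * L)) := Real.exp_le_exp.2 hint
    _ = (Real.exp (a * L))⁻¹ := Real.exp_neg _
    _ ≤ (a * L + 1)⁻¹ := inv_anti₀ (by linarith) (Real.add_one_le_exp _)
    _ ≤ 1 - a * L / 2 := by
      rw [inv_le_iff_one_le_mul₀ (by linarith)]
      nlinarith

namespace IsPruferAngle

theorem abs_spectral_mul_mem_Icc (h : IsPruferAngle L q s θ) (hL : 0 < L) (hk : ∀ x, |q x| ≤ k)
    (hkL : k * L ≤ 1 / 1000) (hn : θ L = Real.pi * n) (hn0 : n ≠ 0) :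
    |s| * L ∈ Icc (3 * |(n : ℝ)|) (4 * |(n : ℝ)|) := by
  have hn1 : (1 : ℝ) ≤ |(n : ℝ)| := by exact_mod_cast Int.one_le_abs hn0
  have hlow := h.pi_mul_abs_sub_le hL hk hn
  have hup : |s| * L ≤ Real.pi * |(n : ℝ)| + k * L := by
    have := abs_sub_abs_le_abs_sub (s * L) (θ L)
    rw [abs_sub_comm, hn, abs_mul, abs_mul, abs_of_pos Real.pi_pos, abs_of_pos hL, ← hn] at this
    linarith [h.abs_sub_mul_le hk (right_mem_Icc.2 hL.le)]
  constructor <;> nlinarith [Real.pi_gt_d2, Real.pi_lt_d2]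

theorem abs_mul_abs_integral_amplitude_mul_sin_mem_Icc (h : IsPruferAngle L q s θ) (hL : 0 ≤ L)
    (hs : s ≠ 0) (hp : Continuous p) (hq : Continuous q)
    (hderiv : ∀ x ∈ Ioo 0 L, HasDerivAt (fun x => p x + q x) ((q x - p x) * (p x + q x)) x)
    (hsin : Real.sin (θ L) = 0) (ha : 0 ≤ a) (haL : a * L ≤ 1) (hpq : ∀ x, p x + |q x| ≤ -a) :
    |s| * |∫ x in (0 : ℝ)..L, amplitude p q θ x * Real.sin (θ x)| ∈ Icc (a * L / 2) 2 := by
  have hpos := amplitude_pos p q θ L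
  have hamp := amplitude_le_one_sub hL hp hq h.continuous ha haL hpq
  have hcos : |amplitude p q θ L * Real.cos (θ L)| ≤ amplitude p q θ L := by
    rw [abs_mul, abs_of_pos hpos]
    exact mul_le_of_le_one_right hpos.le (Real.abs_cos_le_one _)
  have haL0 := mul_nonneg ha hL
  rw [← abs_mul, h.mul_integral_amplitude_mul_sin hL hs hp hq hderiv hsin]
  rw [abs_le] at hcos
  rw [abs_of_nonneg (by linarith)]
  constructor <;> linarith

theorem abs_mul_norm_pairing_mode_controlProfile_mem_Icc (h : IsPruferAngle L q s θ) (hL : 0 < L)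
    (hp : Continuous p) (hpk : ∀ x, |p x| ≤ 3 * k) (hq : IsCoupling L k q)
    (hkL : k * L ≤ 1 / 1000)
    (hderiv : ∀ x ∈ Ioo 0 L, HasDerivAt (fun x => p x + q x) ((q x - p x) * (p x + q x)) x)
    (ha : 0 ≤ a) (haL : a * L ≤ 1) (hpq : ∀ x, p x + |q x| ≤ -a)
    (hn : θ L = Real.pi * n) (hn0 : n ≠ 0) :
    |(n : ℝ)| * ‖pairing L (mode L n p q θ) controlProfile‖ ∈ Icc (a * L / 10) (7 / 10) := by
  obtain ⟨hb, hb'⟩ := h.inv_overlap_amplitude_mem_Icc hL hp hpk hq hkL hn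
  obtain ⟨hs, hs'⟩ := h.abs_spectral_mul_mem_Icc hL hq.abs_le hkL hn hn0
  have hs0 : s ≠ 0 := fun h0 => by
    rw [h0, abs_zero, zero_mul] at hs
    linarith [abs_pos.2 (Int.cast_ne_zero (α := ℝ).2 hn0)]
  obtain ⟨hJ, hJ'⟩ := h.abs_mul_abs_integral_amplitude_mul_sin_mem_Icc hL.le hs0 hp
    hq.continuous hderiv (sin_eq_zero_of_eq_pi_mul_int hn) ha haL hpq
  rw [pairing_mode_controlProfile, norm_mul, Complex.norm_I, mul_one, Complex.norm_real,
    Real.norm_eq_abs, abs_mul, abs_mul, abs_of_pos (one_div_pos.2 hL),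
    abs_of_pos (show 0 < (overlap L n (amplitude p q θ) θ)⁻¹ by linarith)]
  generalize (overlap L n (amplitude p q θ) θ)⁻¹ = b at *
  generalize (∫ x in (0 : ℝ)..L, amplitude p q θ x * Real.sin (θ x)) = J at *
  have hnJ : a * L ^ 2 / 8 ≤ |(n : ℝ)| * |J| := by
    nlinarith [mul_le_mul_of_nonneg_right hs' (abs_nonneg J), mul_le_mul_of_nonneg_right hJ hL.le]
  have hnJ' : |(n : ℝ)| * |J| ≤ 2 / 3 * L := by
    nlinarith [mul_le_mul_of_nonneg_right hs (abs_nonneg J), mul_le_mul_of_nonneg_right hJ' hL.le]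
  rw [show |(n : ℝ)| * (b * (1 / L * |J|)) = b * (|(n : ℝ)| * |J|) / L by ring]
  constructor
  · rw [le_div_iff₀ hL]
    nlinarith [mul_le_mul hb hnJ (by positivity) (by linarith), mul_nonneg ha (sq_nonneg L)]
  · rw [div_le_iff₀ hL]
    nlinarith [mul_le_mul hb' hnJ' (by positivity) (by norm_num)]

end IsPruferAngle

end Moment

section Riesz

theorem hasSum_one_div_int_sq : HasSum (fun n : ℤ => 1 / (n : ℝ) ^ 2) (Real.pi ^ 2 / 3) := by
  have hneg : (fun n : ℕ => 1 / ((-(n : ℤ) : ℤ) : ℝ) ^ 2) = fun n : ℕ => 1 / (n : ℝ) ^ 2 := by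
    simp
  convert! HasSum.of_nat_of_neg (f := fun n : ℤ => 1 / (n : ℝ) ^ 2) hasSum_zeta_two
    (by rw [hneg]; exact hasSum_zeta_two) using 1
  simp
  ring

theorem one_div_one_add_int_sq_le (n : ℤ) :
    1 / (1 + (n : ℝ) ^ 2) ≤ (if n = 0 then 1 else 0) + 1 / (n : ℝ) ^ 2 := by
  split_ifs with hn
  · simp [hn]
  · rw [zero_add]
    have : 0 < (n : ℝ) ^ 2 := by positivity
    exact one_div_le_one_div_of_le this (by linarith)

theorem summable_one_div_one_add_int_sq : Summable fun n : ℤ => 1 / (1 + (n : ℝ) ^ 2) :=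
  ((hasSum_ite_eq 0 1).add hasSum_one_div_int_sq).summable.of_nonneg_of_le
    (fun _ => by positivity) one_div_one_add_int_sq_le

theorem tsum_one_div_one_add_int_sq_le_five : ∑' n : ℤ, 1 / (1 + (n : ℝ) ^ 2) ≤ 5 := by
  have := hasSum_le one_div_one_add_int_sq_le summable_one_div_one_add_int_sq.hasSum
    ((hasSum_ite_eq 0 1).add hasSum_one_div_int_sq)
  nlinarith [Real.pi_pos, Real.pi_lt_d2]

variable {L k : ℝ} {q : ℝ → ℝ}

theorem memLp_polar {r θ : ℝ → ℝ} (hr : Continuous r) (hθ : Continuous θ) (L : ℝ) :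
    MemLp (polar r θ) 2 (volume.restrict (Ioo 0 L)) :=
  memLp_restrict_Ioo_of_continuousOn (continuous_polar hr hθ).continuousOn 2

theorem memLp_polar_amplitude {p θ : ℝ → ℝ} (hp : Continuous p) (hq : Continuous q)
    (hθ : Continuous θ) (L : ℝ) :
    MemLp (polar (amplitude p q θ) θ) 2 (volume.restrict (Ioo 0 L)) :=
  memLp_polar (continuous_amplitude hp hq hθ) hθ L

theorem memLp_psi0 (L : ℝ) (n : ℤ) : MemLp (psi0 L n) 2 (volume.restrict (Ioo 0 L)) :=
  psi0_eq_polar L n ▸ memLp_polar continuous_const (continuous_phase L n) L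

theorem inner_toLp_polar (hL : 0 < L) {r θ r' θ' : ℝ → ℝ}
    (h : MemLp (polar r θ) 2 (volume.restrict (Ioo 0 L)))
    (h' : MemLp (polar r' θ') 2 (volume.restrict (Ioo 0 L))) :
    inner ℂ (h.toLp _) (h'.toLp _) =
      ((2 * ∫ x in (0 : ℝ)..L, r' x * r x * Real.cos (θ' x - θ x) : ℝ) : ℂ) := by
  have hpair := pairing_smul_polar L 1 1 r' θ' r θ
  simp only [one_smul, map_one, one_mul] at hpair
  have hL' : (L : ℂ) ≠ 0 := Complex.ofReal_ne_zero.2 hL.ne'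
  rw [inner_toLp_toLp hL, show pairing L (polar r' θ') (polar r θ) = _ from hpair]
  push_cast
  field_simp

theorem norm_toLp_polar_sq (hL : 0 < L) {r θ : ℝ → ℝ}
    (h : MemLp (polar r θ) 2 (volume.restrict (Ioo 0 L))) :
    ‖h.toLp _‖ ^ 2 = 2 * ∫ x in (0 : ℝ)..L, r x ^ 2 := by
  have hinner := inner_toLp_polar hL h h
  simp only [sub_self, Real.cos_zero, mul_one, ← sq] at hinner
  rw [inner_self_eq_norm_sq_to_K] at hinner
  exact Complex.ofReal_injective (by simpa using hinner)

theorem norm_toLp_polar_amplitude_mem_Icc {θ : ℝ → ℝ} (hL : 0 < L) (hq : IsCoupling L k q)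
    (hkL : k * L ≤ 1 / 1000) (hθ : Continuous θ) :
    ‖(memLp_polar_amplitude continuous_zero hq.continuous hθ L).toLp _‖ ∈ Icc √L (2 * √L) := by
  obtain ⟨hlow, hup⟩ := abs_le.1 (abs_mean_amplitude_zero_left_sq_sub_one_le hL hq hkL hθ)
  have hsq := norm_toLp_polar_sq hL (memLp_polar_amplitude continuous_zero hq.continuous hθ L)
  generalize (∫ x in (0 : ℝ)..L, amplitude 0 q θ x ^ 2) = J at *
  rw [one_div_mul_eq_div] at hlow hup
  have hJ : 1 / 2 * L ≤ J := (le_div_iff₀ hL).1 (by linarith)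
  have hJ' : J ≤ 2 * L := (div_le_iff₀ hL).1 (by linarith)
  refine ⟨Real.sqrt_le_iff.2 ⟨norm_nonneg _, by linarith⟩,
    le_of_sq_le_sq ?_ (by positivity)⟩
  rw [mul_pow, Real.sq_sqrt hL.le]
  linarith

namespace IsPruferAngle

theorem spectral_ne {s s' : ℝ} {θ θ' : ℝ → ℝ} (h : IsPruferAngle L q s θ)
    (h' : IsPruferAngle L q s' θ') (hL : 0 ≤ L) {k : ℝ≥0} (hk : ∀ x, |q x| ≤ k)
    (hne : θ L ≠ θ' L) : s ≠ s' := by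
  rintro rfl
  have := h.dist_apply_le_gronwallBound hL hk h'
  rw [dist_self, gronwallBound_ε0_δ0, dist_le_zero] at this
  exact hne this

section

variable {s : ℝ} {θ : ℝ → ℝ} {n : ℤ}

theorem norm_polar_sub_psi0_sq_le (h : IsPruferAngle L q s θ) (hL : 0 < L)
    (hq : IsCoupling L k q) (hkL : k * L ≤ 1 / 1000) (hn : θ L = Real.pi * n) {x : ℝ}
    (hx : x ∈ Icc 0 L) : ‖polar (amplitude 0 q θ) θ x - psi0 L n x‖ ^ 2 ≤
      32 * (k * L) ^ 2 * (1 / (1 + (n : ℝ) ^ 2)) := by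
  rw [psi0_eq_polar]
  calc ‖polar (amplitude 0 q θ) θ x - polar 1 (phase L n) x‖ ^ 2
      ≤ 2 * (|amplitude 0 q θ x - 1| + |θ x - phase L n x|) ^ 2 :=
        norm_polar_sub_polar_one_sq_le _ _ _ _
    _ ≤ 2 * (2 * (k * L / √(1 + n ^ 2)) + 2 * (k * L / √(1 + n ^ 2))) ^ 2 := by
        gcongr
        · exact h.abs_amplitude_zero_left_sub_one_le hL hq hkL hn hx
        · exact h.abs_sub_phase_le hL hq hkL hn hx
    _ = 32 * (k * L) ^ 2 * (1 / (1 + (n : ℝ) ^ 2)) := by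
        rw [← add_mul, mul_pow, div_pow, Real.sq_sqrt (by positivity)]
        ring

theorem norm_toLp_polar_sub_toLp_psi0_sq_le (h : IsPruferAngle L q s θ) (hL : 0 < L)
    (hq : IsCoupling L k q) (hkL : k * L ≤ 1 / 1000) (hn : θ L = Real.pi * n) :
    ‖(memLp_polar_amplitude continuous_zero hq.continuous h.continuous L).toLp _ -
        (memLp_psi0 L n).toLp _‖ ^ 2 ≤ 32 * (k * L) ^ 2 * L * (1 / (1 + (n : ℝ) ^ 2)) := by
  rw [← MemLp.toLp_sub]
  refine (norm_toLp_sq_le_mul hL.le _ fun x hx => h.norm_polar_sub_psi0_sq_le hL hq hkL hn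
    (Ioo_subset_Icc_self hx)).trans_eq ?_
  ring

end

variable {s : ℤ → ℝ} {θ : ℤ → ℝ → ℝ}

theorem pairwise_inner_toLp_polar_eq_zero (h : ∀ n, IsPruferAngle L q (s n) (θ n)) (hL : 0 < L)
    (hq : IsCoupling L k q) (hn : ∀ n : ℤ, θ n L = Real.pi * n) : Pairwise fun n m =>
      inner ℂ ((memLp_polar_amplitude continuous_zero hq.continuous (h n).continuous L).toLp _)
        ((memLp_polar_amplitude continuous_zero hq.continuous (h m).continuous L).toLp _) = 0 := by
  intro n m hnm
  have hne : θ m L ≠ θ n L := by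
    rw [hn, hn]
    exact fun heq => hnm (Int.cast_injective (mul_left_cancel₀ Real.pi_ne_zero heq)).symm
  have hs := (h m).spectral_ne (h n) hL.le (k := ⟨k, hq.nonneg⟩) hq.abs_le hne
  have hsin : Real.sin (θ m L - θ n L) = 0 :=
    sin_eq_zero_of_eq_pi_mul_int (n := m - n) (by rw [hn, hn]; push_cast; ring)
  rw [inner_toLp_polar hL, (h m).integral_amplitude_mul_amplitude_mul_cos_sub_eq_zero (h n) hL.le
    hq.continuous hs hsin, mul_zero, Complex.ofReal_zero]

theorem eq_zero_of_inner_toLp_polar_eq_zero (h : ∀ n, IsPruferAngle L q (s n) (θ n)) (hL : 0 < L)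
    (hq : IsCoupling L k q) (hkL : k * L ≤ 1 / 1000) (hn : ∀ n : ℤ, θ n L = Real.pi * n)
    {f : L2Space L} (hf : ∀ n, inner ℂ
      ((memLp_polar_amplitude continuous_zero hq.continuous (h n).continuous L).toLp _) f = 0) :
    f = 0 := by
  have hclose := fun n => (h n).norm_toLp_polar_sub_toLp_psi0_sq_le hL hq hkL (hn n)
  have hS := summable_one_div_one_add_int_sq.mul_left (32 * (k * L) ^ 2 * L)
  have hS' := Summable.of_nonneg_of_le (fun n => sq_nonneg _) hclose hS
  refine eq_zero_of_inner_eq_zero_of_tsum_norm_sub_sq_lt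
    (hasSum_norm_inner_psi0_sq hL (memLp_psi0 L)) hS' ?_ hf
  have hkL0 : (k * L) ^ 2 ≤ 1 / 1000 := by nlinarith [mul_nonneg hq.nonneg hL.le]
  calc _ ≤ ∑' n : ℤ, 32 * (k * L) ^ 2 * L * (1 / (1 + (n : ℝ) ^ 2)) :=
        hS'.tsum_le_tsum hclose hS
    _ = 32 * (k * L) ^ 2 * L * ∑' n : ℤ, 1 / (1 + (n : ℝ) ^ 2) := tsum_mul_left
    _ ≤ 32 * (1 / 1000) * L * 5 := by
        gcongr
        exact tsum_one_div_one_add_int_sq_le_five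
    _ < 2 * L := by linarith

end IsPruferAngle

theorem mode_eq_smul {p θ : ℝ → ℝ} (hp : Continuous p) (hq : Continuous q) (hθ : Continuous θ)
    (L : ℝ) (n : ℤ) (x : ℝ) : mode L n p q θ x =
      (Real.exp (∫ t in (0 : ℝ)..x, p t) : ℂ) •
        (((overlap L n (amplitude p q θ) θ)⁻¹ : ℝ) : ℂ) • polar (amplitude 0 q θ) θ x := by
  rw [mode, smul_comm]
  congr 1
  ext i
  fin_cases i <;>
    simp [polar, amplitude_eq_exp_integral_mul hp hq hθ x, mul_assoc, -Complex.ofReal_exp]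

theorem continuous_mode {p θ : ℝ → ℝ} (hp : Continuous p) (hq : Continuous q) (hθ : Continuous θ)
    (L : ℝ) (n : ℤ) : Continuous (mode L n p q θ) := by
  have := continuous_polar (continuous_amplitude hp hq hθ) hθ
  unfold mode
  fun_prop

theorem memLp_mode {p θ : ℝ → ℝ} (hp : Continuous p) (hq : Continuous q) (hθ : Continuous θ)
    (L : ℝ) (n : ℤ) : MemLp (mode L n p q θ) 2 (volume.restrict (Ioo 0 L)) :=
  memLp_restrict_Ioo_of_continuousOn (continuous_mode hp hq hθ L n).continuousOn 2

theorem exists_continuousLinearEquiv_smul_toLp_polar_eq_toLp_mode {p : ℝ → ℝ} (hp : Continuous p)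
    (hq : Continuous q) (L : ℝ) :
    ∃ A : L2Space L ≃L[ℂ] L2Space L, ∀ (n : ℤ) (θ : ℝ → ℝ) (hθ : Continuous θ),
      A ((((overlap L n (amplitude p q θ) θ)⁻¹ : ℝ) : ℂ) •
          (memLp_polar_amplitude continuous_zero hq hθ L).toLp _) =
        (memLp_mode hp hq hθ L n).toLp _ := by
  have hm : Continuous fun x => (Real.exp (∫ t in (0 : ℝ)..x, p t) : ℂ) := by
    have := intervalIntegral.continuous_primitive (μ := volume) hp.intervalIntegrable 0
    fun_prop
  obtain ⟨A, hA⟩ := exists_continuousLinearEquiv_toLp_eq_toLp_smul (E := C2) (p := 2) hm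
    (fun x => Complex.ofReal_ne_zero.2 (Real.exp_pos _).ne') 0 L
  refine ⟨A, fun n θ hθ => ?_⟩
  have hu := (memLp_polar_amplitude continuous_zero hq hθ L).const_smul
    (((overlap L n (amplitude p q θ) θ)⁻¹ : ℝ) : ℂ)
  have hmode : mode L n p q θ =ᵐ[volume.restrict (Ioo 0 L)] fun x =>
      (Real.exp (∫ t in (0 : ℝ)..x, p t) : ℂ) •
        ((((overlap L n (amplitude p q θ) θ)⁻¹ : ℝ) : ℂ) • polar (amplitude 0 q θ) θ) x :=
    ae_of_all _ (mode_eq_smul hp hq hθ L n)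
  have hmu := (memLp_mode hp hq hθ L n).ae_eq hmode
  rw [← MemLp.toLp_const_smul, hA _ hu hmu]
  exact MemLp.toLp_congr _ _ hmode.symm

theorem IsPruferAngle.isRieszBasisL2 {p : ℝ → ℝ} {s : ℤ → ℝ} {θ : ℤ → ℝ → ℝ} {ψ : ℤ → ℝ → C2}
    (h : ∀ n, IsPruferAngle L q (s n) (θ n)) (hL : 0 < L) (hp : Continuous p)
    (hpk : ∀ x, |p x| ≤ 3 * k) (hq : IsCoupling L k q) (hkL : k * L ≤ 1 / 1000)
    (hn : ∀ n : ℤ, θ n L = Real.pi * n) (hψ : ∀ n, ∀ x ∈ Icc 0 L, ψ n x = mode L n p q (θ n) x) :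
    IsRieszBasisL2 L ψ := by
  have hψae : ∀ n, ψ n =ᵐ[volume.restrict (Ioo 0 L)] mode L n p q (θ n) := fun n => by
    filter_upwards [ae_restrict_mem measurableSet_Ioo] with x hx
    exact hψ n x (Ioo_subset_Icc_self hx)
  have hψL : ∀ n, MemLp (ψ n) 2 (volume.restrict (Ioo 0 L)) := fun n =>
    (memLp_mode hp hq.continuous (h n).continuous L n).ae_eq (hψae n).symm
  obtain ⟨A, hA⟩ :=
    exists_continuousLinearEquiv_smul_toLp_polar_eq_toLp_mode hp hq.continuous L
  have hψA := fun n => (MemLp.toLp_congr (hψL n) _ (hψae n)).trans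
    (hA n (θ n) (h n).continuous).symm
  refine ⟨hψL, ?_⟩
  simp only [hψA]
  have hb : ∀ n, ‖(((overlap L n (amplitude p q (θ n)) (θ n))⁻¹ : ℝ) : ℂ)‖ ∈
      Icc (95 / 100 : ℝ) (105 / 100) := fun n => by
    have hbn := (h n).inv_overlap_amplitude_mem_Icc hL hp hpk hq hkL (hn n)
    rwa [Complex.norm_real, Real.norm_of_nonneg (le_trans (by norm_num) hbn.1)]
  have hu := fun n => norm_toLp_polar_amplitude_mem_Icc hL hq hkL (h n).continuous
  refine isRieszBasis_of_orthogonal (pairwise_inner_toLp_polar_eq_zero h hL hq hn)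
    (fun f => eq_zero_of_inner_toLp_polar_eq_zero h hL hq hkL hn)
    (m := 95 / 100 * √L) (M := 105 / 100 * (2 * √L)) (by positivity) (fun n => ?_) (fun n => ?_) A
  · rw [norm_smul]
    exact mul_le_mul (hb n).1 (hu n).1 (by positivity) (norm_nonneg _)
  · rw [norm_smul]
    exact mul_le_mul (hb n).2 (hu n).2 (norm_nonneg _) (by norm_num)

end Riesz

section Family

/- `f` avoids all half-integers, so by the intermediate value theorem the nearest integer to `f t`
does not depend on `t`. -/
theorem eq_of_tendsto_of_abs_sub_int_le {t₀ : ℝ} {f : ℝ → ℝ} (hf : ContinuousOn f (Ioo 0 t₀))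
    {n : ℤ} (hlim : Tendsto f (𝓝[>] 0) (𝓝 n)) (hint : ∀ t ∈ Ioo 0 t₀, ∃ k : ℤ, |f t - k| ≤ 1 / 4)
    {t : ℝ} (ht : t ∈ Ioo 0 t₀) {k : ℤ} (hk : |f t - k| ≤ 1 / 4) : k = n := by
  have hhalf : ∀ u ∈ Ioo 0 t₀, ∀ m : ℤ, f u ≠ m + 1 / 2 := by
    intro u hu m hm
    obtain ⟨k, hk⟩ := hint u hu
    rw [hm, abs_le] at hk
    have hmk : m < k := by exact_mod_cast (by linarith : (m : ℝ) < k)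
    have hkm : k < m + 1 := by exact_mod_cast (by linarith : (k : ℝ) < m + 1)
    omega
  have hnear : ∀ᶠ u in 𝓝[>] (0 : ℝ), |f u - n| < 1 / 4 :=
    Metric.tendsto_nhds.1 hlim (1 / 4) (by norm_num)
  obtain ⟨u, hun, hu⟩ := (hnear.and (Ioo_mem_nhdsGT (ht.1.trans ht.2))).exists
  have hivt : ∀ {a b : ℝ}, a ∈ Ioo 0 t₀ → b ∈ Ioo 0 t₀ → ∀ m : ℤ, f a ≤ m + 1 / 2 →
      ¬ m + 1 / 2 ≤ f b := fun ha hb m hma hmb => by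
    obtain ⟨v, hv, hvm⟩ := isPreconnected_Ioo.intermediate_value ha hb hf ⟨hma, hmb⟩
    exact hhalf v hv m hvm
  rw [abs_lt] at hun
  rw [abs_le] at hk
  rcases lt_trichotomy k n with hlt | heq | hgt
  · have : (k : ℝ) + 1 ≤ n := by exact_mod_cast hlt
    exact absurd (by linarith) (hivt ht hu k (by linarith))
  · exact heq
  · have : (n : ℝ) + 1 ≤ k := by exact_mod_cast hgt
    exact absurd (by linarith) (hivt hu ht n (by linarith))

theorem mu0_eq (L : ℝ) (n : ℤ) : mu0 L n = ((Real.pi * n / L : ℝ) : ℂ) * Complex.I := by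
  rw [mu0]
  push_cast
  ring

variable {L γ γ₀ s : ℝ} {θ : ℝ → ℝ} {n : ℤ} {z : ℂ} {w : ℝ → C2}

theorem abs_deltaExt_le (hL : 0 < L) (hγ : 0 < γ) (h : γ * L ≤ 1 / 4) (x : ℝ) :
    |deltaExt L γ x| ≤ 3 * (γ / 2) := by
  obtain ⟨hlow, hup⟩ := deltaExt_mem_Icc hL hγ h x
  rw [abs_le]
  constructor <;> linarith

theorem exists_isPruferAngle_coupling (hL : 0 < L) (hγ : 0 < γ) (hγL : γ * L ≤ 1 / 4) (s : ℝ) :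
    ∃ θ, IsPruferAngle L (coupling L γ) s θ :=
  have hq := isCoupling_coupling hL hγ hγL
  exists_isPruferAngle hL.le hq.continuous (k := ⟨γ / 2, hq.nonneg⟩) hq.abs_le s

theorem exists_isPruferAngle_coupling_apply_eq (hL : 0 < L) (hγ : 0 < γ) (hγL : γ * L ≤ 1 / 4)
    (y : ℝ) : ∃ s θ, IsPruferAngle L (coupling L γ) s θ ∧ θ L = y :=
  have hq := isCoupling_coupling hL hγ hγL
  exists_isPruferAngle_apply_eq hL hq.continuous (k := ⟨γ / 2, hq.nonneg⟩) hq.abs_le y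

theorem overlap_amplitude_deltaExt_ne_zero (hL : 0 < L) (hγ : 0 < γ) (hγL : γ * L ≤ 1 / 500)
    (h : IsPruferAngle L (coupling L γ) s θ) (hn : θ L = Real.pi * n) :
    overlap L n (amplitude (deltaExt L γ) (coupling L γ) θ) θ ≠ 0 :=
  h.overlap_amplitude_ne_zero hL (continuous_deltaExt hL hγ (by linarith))
    (abs_deltaExt_le hL hγ (by linarith)) (isCoupling_coupling hL hγ (by linarith)) (by linarith) hn

theorem overlap_amplitude_neg_deltaExt_ne_zero (hL : 0 < L) (hγ : 0 < γ) (hγL : γ * L ≤ 1 / 500)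
    (h : IsPruferAngle L (coupling L γ) s θ) (hn : θ L = Real.pi * n) :
    overlap L n (amplitude (-deltaExt L γ) (coupling L γ) θ) θ ≠ 0 :=
  h.overlap_amplitude_ne_zero hL (continuous_deltaExt hL hγ (by linarith)).neg
    (fun x => (abs_neg _).trans_le (abs_deltaExt_le hL hγ (by linarith) x))
    (isCoupling_coupling hL hγ (by linarith)) (by linarith) hn

theorem isEigenfunction_S0_iff_deltaExt : IsEigenfunction L (S0 L γ) z w ↔
    IsSystemEigenfunction L (-deltaExt L γ) (coupling L γ) z w :=
  isEigenfunction_S0_iff (fun _ hx => congrArg Neg.neg (deltaExt_of_mem hx))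
    fun _ => coupling_of_mem

theorem isEigenfunction_S0Adj_conj_iff_deltaExt :
    IsEigenfunction L (S0Adj L γ) (conj (s * Complex.I : ℂ)) w ↔
      IsSystemEigenfunction L (deltaExt L γ) (coupling L γ) (s * Complex.I) w := by
  have hconj : -conj (s * Complex.I : ℂ) = s * Complex.I := by simp
  rw [isEigenfunction_S0Adj_iff (fun _ => deltaExt_of_mem) fun _ => coupling_of_mem, hconj]

theorem continuousOn_spectral {s : ℝ → ℝ} {θ : ℝ → ℝ → ℝ} {y : ℝ} (hL : 0 < L)
    (hγ₀ : γ₀ * L ≤ 1 / 4) (h : ∀ γ ∈ Ioo 0 γ₀, IsPruferAngle L (coupling L γ) (s γ) (θ γ))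
    (hy : ∀ γ ∈ Ioo 0 γ₀, θ γ L = y) : ContinuousOn s (Ioo 0 γ₀) := by
  have hq : ∀ γ ∈ Ioo 0 γ₀, Continuous (coupling L γ) := fun γ hγ =>
    (isCoupling_coupling hL hγ.1 ((mul_le_mul_of_nonneg_right hγ.2.le hL.le).trans hγ₀)).continuous
  intro γ hγ
  refine Metric.tendsto_nhds.2 fun ε hε => ?_
  filter_upwards [eventually_abs_deltaExt_sub_lt hL hγ₀ hε hγ, self_mem_nhdsWithin]
    with γ' hclose hγ'
  refine ((h γ' hγ').abs_spectral_sub_le (η := ε / 3) hL (hq γ' hγ') (hq γ hγ) (h γ hγ)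
    (fun x hx => ?_) ((hy γ' hγ').trans (hy γ hγ).symm)).trans_lt (by linarith)
  rw [coupling, coupling, ← sub_div, abs_div, abs_of_pos (zero_lt_three' ℝ)]
  linarith [hclose x hx]

theorem tendsto_spectral {s : ℝ → ℝ} {θ : ℝ → ℝ → ℝ} (hL : 0 < L) (h0 : 0 < γ₀)
    (hγ₀ : γ₀ * L ≤ 1 / 4) (h : ∀ γ ∈ Ioo 0 γ₀, IsPruferAngle L (coupling L γ) (s γ) (θ γ))
    (hn : ∀ γ ∈ Ioo 0 γ₀, θ γ L = Real.pi * n) :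
    Tendsto s (𝓝[>] 0) (𝓝 (Real.pi * n / L)) := by
  rw [tendsto_iff_norm_sub_tendsto_zero]
  have hhalf : Tendsto (fun γ : ℝ => γ / 2) (𝓝[>] 0) (𝓝 0) := by
    simpa using (tendsto_id.div_const (2 : ℝ)).mono_left (nhdsWithin_le_nhds (a := (0 : ℝ)))
  refine squeeze_zero' (Eventually.of_forall fun _ => norm_nonneg _) ?_ hhalf
  filter_upwards [Ioo_mem_nhdsGT h0] with γ hγ
  have hγL := (mul_le_mul_of_nonneg_right hγ.2.le hL.le).trans hγ₀
  exact (h γ hγ).abs_spectral_sub_le_coupling hL (isCoupling_coupling hL hγ.1 hγL).abs_le (hn γ hγ)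

theorem exists_isPerturbedEigenfamily (hL : 0 < L) (h0 : 0 < γ₀) (hγ₀ : γ₀ * L ≤ 1 / 500) :
    ∃ (μ : ℤ → ℝ → ℂ) (ψ χ : ℤ → ℝ → ℝ → C2), IsPerturbedEigenfamily L γ₀ μ ψ χ := by
  have hγL : ∀ γ ∈ Ioo 0 γ₀, γ * L ≤ 1 / 500 := fun γ hγ =>
    (mul_le_mul_of_nonneg_right hγ.2.le hL.le).trans hγ₀
  have hex : ∀ (n : ℤ) (γ : ℝ), ∃ s θ, γ ∈ Ioo 0 γ₀ →
      IsPruferAngle L (coupling L γ) s θ ∧ θ L = Real.pi * n := fun n γ => by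
    by_cases hγ : γ ∈ Ioo 0 γ₀
    · obtain ⟨s, θ, h⟩ := exists_isPruferAngle_coupling_apply_eq hL hγ.1
        ((hγL γ hγ).trans (by norm_num)) (Real.pi * n)
      exact ⟨s, θ, fun _ => h⟩
    · exact ⟨0, 0, fun h => absurd h hγ⟩
  choose s θ h using hex
  have hp := fun γ hγ => continuous_deltaExt hL hγ.1 ((hγL γ hγ).trans (by norm_num))
  have hq := fun γ hγ => (isCoupling_coupling hL hγ.1 ((hγL γ hγ).trans (by norm_num))).continuous
  have hψ := fun n γ hγ =>
    overlap_amplitude_neg_deltaExt_ne_zero hL hγ.1 (hγL γ hγ) (h n γ hγ).1 (h n γ hγ).2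
  have hχ := fun n γ hγ =>
    overlap_amplitude_deltaExt_ne_zero hL hγ.1 (hγL γ hγ) (h n γ hγ).1 (h n γ hγ).2
  refine ⟨fun n γ => s n γ * Complex.I, fun n γ => mode L n (-deltaExt L γ) (coupling L γ) (θ n γ),
    fun n γ => mode L n (deltaExt L γ) (coupling L γ) (θ n γ), fun n => ?_, fun n => ?_,
    fun n γ hγ => ?_, fun n γ hγ => ?_, fun n γ hγ => pairing_mode_psi0 (hψ n γ hγ),
    fun n γ hγ => ?_⟩
  · exact (Complex.continuous_ofReal.comp_continuousOn (continuousOn_spectral hL (by linarith)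
      (fun γ hγ => (h n γ hγ).1) fun γ hγ => (h n γ hγ).2)).mul continuousOn_const
  · rw [mu0_eq]
    exact ((Complex.continuous_ofReal.tendsto _).comp (tendsto_spectral hL h0 (by linarith)
      (fun γ hγ => (h n γ hγ).1) fun γ hγ => (h n γ hγ).2)).mul_const _
  · exact isEigenfunction_S0_iff_deltaExt.2
      ((h n γ hγ).1.isSystemEigenfunction_mode hL.le (hp γ hγ).neg (hq γ hγ) (h n γ hγ).2
        (hψ n γ hγ))
  · exact isEigenfunction_S0Adj_conj_iff_deltaExt.2
      ((h n γ hγ).1.isSystemEigenfunction_mode hL.le (hp γ hγ) (hq γ hγ) (h n γ hγ).2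
        (hχ n γ hγ))
  · rw [← conj_pairing, pairing_mode_psi0 (hχ n γ hγ), map_one]

theorem IsEigenfunction.eq_im_mul_I (h : IsEigenfunction L (S0 L γ) z w) (hL : 0 < L) (hγ : 0 < γ)
    (hγL : γ * L ≤ 1 / 4) : z = z.im * Complex.I := by
  have hre := (isEigenfunction_S0_iff_deltaExt.1 h).re_eq_zero hL
    (continuous_deltaExt hL hγ hγL).neg (isCoupling_coupling hL hγ hγL).continuous
  apply Complex.ext <;> simp [hre]

theorem IsEigenfunction.exists_int_apply_eq (h : IsEigenfunction L (S0 L γ) z w) (hL : 0 < L)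
    (hγ : 0 < γ) (hγL : γ * L ≤ 1 / 4) (hθ : IsPruferAngle L (coupling L γ) z.im θ) :
    ∃ k : ℤ, θ L = Real.pi * k :=
  IsSystemEigenfunction.exists_int_apply_eq
    (isEigenfunction_S0_iff_deltaExt.1 (h.eq_im_mul_I hL hγ hγL ▸ h)) hL.le
    (continuous_deltaExt hL hγ hγL).neg (isCoupling_coupling hL hγ hγL).continuous hθ

theorem IsPruferAngle.abs_mul_div_pi_sub_le (h : IsPruferAngle L (coupling L γ) s θ) (hL : 0 < L)
    (hγ : 0 < γ) (hγL : γ * L ≤ 1 / 4) (hn : θ L = Real.pi * n) :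
    |s * L / Real.pi - n| ≤ 1 / 4 := by
  have hle := h.abs_spectral_sub_le_coupling hL (isCoupling_coupling hL hγ hγL).abs_le hn
  have : s * L / Real.pi - n = (s - Real.pi * n / L) * L / Real.pi := by field_simp
  rw [this, abs_div, abs_mul, abs_of_pos hL, abs_of_pos Real.pi_pos, div_le_iff₀ Real.pi_pos]
  nlinarith [Real.pi_gt_three]

theorem IsPruferAngle.norm_pairing_mode_deltaExt_controlProfile
    (h : IsPruferAngle L (coupling L γ) s θ) (hL : 0 < L) (hγ : 0 < γ) (hγL : γ * L ≤ 1 / 500)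
    (hn : θ L = Real.pi * n) (hn0 : n ≠ 0) :
    γ * (L / 100 / |(n : ℝ)|) <
        ‖pairing L (mode L n (deltaExt L γ) (coupling L γ) θ) controlProfile‖ ∧
      ‖pairing L (mode L n (deltaExt L γ) (coupling L γ) θ) controlProfile‖ < 1 / |(n : ℝ)| := by
  have hγL' : γ * L ≤ 1 / 4 := by linarith
  have hderiv : ∀ x ∈ Ioo 0 L, HasDerivAt (fun x => deltaExt L γ x + coupling L γ x)
      ((coupling L γ x - deltaExt L γ x) * (deltaExt L γ x + coupling L γ x)) x := fun x hx => by
    have hδ := hasDerivAt_deltaExt hL hγ hγL' hx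
    convert! hδ.add (hδ.div_const 3) using 1
    rw [coupling]
    ring
  have hneg : ∀ x, deltaExt L γ x + |coupling L γ x| ≤ -(γ / 3) := fun x => by
    have hδ := (deltaExt_mem_Icc hL hγ hγL' x).2
    rw [coupling, abs_of_nonpos (by linarith)]
    linarith
  obtain ⟨hlow, hup⟩ := h.abs_mul_norm_pairing_mode_controlProfile_mem_Icc hL
    (continuous_deltaExt hL hγ hγL') (abs_deltaExt_le hL hγ hγL') (isCoupling_coupling hL hγ hγL')
    (by linarith) hderiv (by positivity) (by linarith) hneg hn hn0
  have hn_pos : 0 < |(n : ℝ)| := abs_pos.2 (Int.cast_ne_zero.2 hn0)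
  have := mul_pos hγ hL
  rw [← mul_div_assoc, div_lt_iff₀' hn_pos, lt_div_iff₀' hn_pos]
  constructor <;> linarith

theorem IsPruferAngle.norm_mul_I_sub_mu0_lt (h : IsPruferAngle L (coupling L γ) s θ) (hL : 0 < L)
    (hγ : 0 < γ) (hγL : γ * L ≤ 1 / 4) (hn : θ L = Real.pi * n) :
    ‖(s * Complex.I : ℂ) - mu0 L n‖ < 1 / (4 * L) := by
  rw [mu0_eq, ← sub_mul, ← Complex.ofReal_sub, norm_mul, Complex.norm_I, mul_one, Complex.norm_real,
    lt_div_iff₀ (by positivity)]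
  have := h.abs_spectral_sub_le_coupling hL (isCoupling_coupling hL hγ hγL).abs_le hn
  rw [Real.norm_eq_abs]
  nlinarith

namespace IsPerturbedEigenfamily

variable {μ : ℤ → ℝ → ℂ} {ψ χ : ℤ → ℝ → ℝ → C2}

theorem apply_eq_pi_mul (h : IsPerturbedEigenfamily L γ₀ μ ψ χ) (hL : 0 < L)
    (hγ₀ : γ₀ * L ≤ 1 / 4) (hγ : γ ∈ Ioo 0 γ₀) (n : ℤ)
    (hθ : IsPruferAngle L (coupling L γ) (μ n γ).im θ) : θ L = Real.pi * n := by
  have hγL : ∀ t ∈ Ioo 0 γ₀, t * L ≤ 1 / 4 := fun t ht =>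
    (mul_le_mul_of_nonneg_right ht.2.le hL.le).trans hγ₀
  have hcont : ContinuousOn (fun t => (μ n t).im * L / Real.pi) (Ioo 0 γ₀) :=
    ((Complex.continuous_im.comp_continuousOn (h.continuousOn n)).mul
      continuousOn_const).div_const _
  have hlim : Tendsto (fun t => (μ n t).im * L / Real.pi) (𝓝[>] 0) (𝓝 n) := by
    have hmu0 : (mu0 L n).im * L / Real.pi = n := by
      rw [mu0_eq, Complex.im_ofReal_mul, Complex.I_im]
      field_simp
    exact hmu0 ▸ (((Complex.continuous_im.tendsto _).comp (h.tendsto_zero n)).mul_const L).div_const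
      Real.pi
  have hint : ∀ t ∈ Ioo 0 γ₀, ∃ k : ℤ, |(μ n t).im * L / Real.pi - k| ≤ 1 / 4 := fun t ht => by
    obtain ⟨θ, hθ⟩ := exists_isPruferAngle_coupling hL ht.1 (hγL t ht) (μ n t).im
    obtain ⟨k, hk⟩ := (h.eigen n t ht).exists_int_apply_eq hL ht.1 (hγL t ht) hθ
    exact ⟨k, hθ.abs_mul_div_pi_sub_le hL ht.1 (hγL t ht) hk⟩
  obtain ⟨k, hk⟩ := (h.eigen n γ hγ).exists_int_apply_eq hL hγ.1 (hγL γ hγ) hθ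
  rw [hk, eq_of_tendsto_of_abs_sub_int_le hcont hlim hint hγ
    (hθ.abs_mul_div_pi_sub_le hL hγ.1 (hγL γ hγ) hk)]

theorem exists_mode (h : IsPerturbedEigenfamily L γ₀ μ ψ χ) (hL : 0 < L) (hγ₀ : γ₀ * L ≤ 1 / 4)
    (hγ : γ ∈ Ioo 0 γ₀) (n : ℤ) :
    ∃ s θ, IsPruferAngle L (coupling L γ) s θ ∧ θ L = Real.pi * n ∧ μ n γ = s * Complex.I ∧
      (∀ x ∈ Icc 0 L, ψ n γ x = mode L n (-deltaExt L γ) (coupling L γ) θ x) ∧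
      ∀ x ∈ Icc 0 L, χ n γ x = mode L n (deltaExt L γ) (coupling L γ) θ x := by
  have hγL := (mul_le_mul_of_nonneg_right hγ.2.le hL.le).trans hγ₀
  obtain ⟨θ, hθ⟩ := exists_isPruferAngle_coupling hL hγ.1 hγL (μ n γ).im
  have hμ := (h.eigen n γ hγ).eq_im_mul_I hL hγ.1 hγL
  have hp := continuous_deltaExt hL hγ.1 hγL
  have hq := (isCoupling_coupling hL hγ.1 hγL).continuous
  have hψ := isEigenfunction_S0_iff_deltaExt.1 (hμ ▸ h.eigen n γ hγ)
  have hχ := isEigenfunction_S0Adj_conj_iff_deltaExt.1 (hμ ▸ h.eigen_adj n γ hγ)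
  refine ⟨_, θ, hθ, h.apply_eq_pi_mul hL hγ₀ hγ n hθ, hμ,
    hψ.eq_mode hL.le hp.neg hq hθ (h.norm_psi n γ hγ), hχ.eq_mode hL.le hp hq hθ ?_⟩
  rw [← conj_pairing, h.norm_chi n γ hγ, map_one]

end IsPerturbedEigenfamily

end Family

end WaterTank

end

theorem mainTheorem4 (L : ℝ) (hL : 0 < L) :
    ∃ γ₀ c C : ℝ, 0 < γ₀ ∧ γ₀ < 2 / L ∧ 0 < c ∧ 0 < C ∧
      (∃ (μ : ℤ → ℝ → ℂ) (ψ χ : ℤ → ℝ → ℝ → WaterTank.C2),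
        WaterTank.IsPerturbedEigenfamily L γ₀ μ ψ χ) ∧
      ∀ (μ : ℤ → ℝ → ℂ) (ψ χ : ℤ → ℝ → ℝ → WaterTank.C2),
        WaterTank.IsPerturbedEigenfamily L γ₀ μ ψ χ →
        ∀ γ ∈ Set.Ioo 0 γ₀,
          WaterTank.IsRieszBasisL2 L (fun n : ℤ => ψ n γ) ∧
          (∀ n : ℤ, ‖WaterTank.pairing L (ψ n γ) (χ n γ)‖ ∈ Set.Ioo (1 / 2 : ℝ) 2) ∧
          (∀ n : ℤ, ‖μ n γ - WaterTank.mu0 L n‖ < 1 / (4 * L)) ∧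
          WaterTank.moment L χ 0 γ = 0 ∧
          ∀ n : ℤ, n ≠ 0 →
            γ * (c / |(n : ℝ)|) < ‖WaterTank.moment L χ n γ‖ ∧
            ‖WaterTank.moment L χ n γ‖ < C / |(n : ℝ)| := by
  have hγ₀ : 1 / 500 / L * L = 1 / 500 := div_mul_cancel₀ _ hL.ne'
  refine ⟨1 / 500 / L, L / 100, 1, by positivity, by gcongr; norm_num, by positivity, one_pos,
    WaterTank.exists_isPerturbedEigenfamily hL (by positivity) hγ₀.le, fun μ ψ χ h γ hγ => ?_⟩
  have hγL : γ * L ≤ 1 / 500 := (mul_le_mul_of_nonneg_right hγ.2.le hL.le).trans_eq hγ₀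
  have hγL' : γ * L ≤ 1 / 4 := by linarith
  choose s θ hθ hend hμ hψ hχ using h.exists_mode hL (by linarith) hγ
  have hδ := WaterTank.continuous_deltaExt hL hγ.1 hγL'
  have hδ_le := WaterTank.abs_deltaExt_le hL hγ.1 hγL'
  have hq := WaterTank.isCoupling_coupling hL hγ.1 hγL'
  have hmoment : ∀ n, WaterTank.moment L χ n γ = _ := fun n =>
    WaterTank.pairing_congr hL.le (hχ n) fun _ _ => rfl
  refine ⟨WaterTank.IsPruferAngle.isRieszBasisL2 hθ hL hδ.neg
      (fun x => (abs_neg _).trans_le (hδ_le x)) hq (by linarith) hend hψ,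
    fun n => ?_, fun n => ?_, ?_, fun n hn => ?_⟩
  · rw [WaterTank.pairing_congr hL.le (hψ n) (hχ n)]
    exact (hθ n).norm_pairing_mode_neg_mode_mem_Ioo hL hδ hδ_le hq (by linarith) (hend n)
  · exact hμ n ▸ (hθ n).norm_mul_I_sub_mu0_lt hL hγ.1 hγL' (hend n)
  · exact (hmoment 0).trans ((hθ 0).pairing_mode_controlProfile_eq_zero hL hq (by simp [hend]))
  · rw [hmoment]
    exact (hθ n).norm_pairing_mode_deltaExt_controlProfile hL hγ.1 hγL (hend n) hn
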